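/- Let $n\ge 1$, $m\ge n$ and $t>n$ be integers. A \emph{$t$-doped POVM} on $n$ data qubits with $m$ ancillas is a POVM $\mu=(\mu_b)_{b\in\{0,1\}^{n+m}}$ of the form $$\mu_b=\operatorname{Tr}_R\big[U^\dagger\,|\Phi_b\rangle\langle\Phi_b|\,U\,(I\otimes|\psi\rangle\langle\psi|)\big],$$ where $\operatorname{Tr}_R$ is the partial trace over the ancillas, $\psi$ is an $m$-qubit stabilizer state, $(\Phi_b)_b$ is an $(n+m)$-qubit stabilizer basis (an orthonormal basis of common eigenvectors of a maximal Abelian group of Pauli strings), and $U$ is the unitary of a circuit on the $n+m$ qubits made of Clifford unitaries and exactly $t$ gates $T=\operatorname{diag}(1,e^{i\pi/4})$. Put $s_\mu=\dim\operatorname{span}\{\mu_b\}_b$, and let $\ell=t-n$, $a=\lfloor t/\ell\rfloor$, $r=t-a\ell$. (i) The maximum $A$ of $s_\mu$ over all $t$-doped POVMs $\mu$ on $n$ data qubits with $m$ ancillas exists and satisfies $$A\;\ge\;2^{-\ell}\,(3^{a+1}-1)^r\,(3^a-1)^{\ell-r}.$$ (ii) The bound is witnessed by disjoint-support generators of the form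 $X\cdots XZ$: there is a $t$-doped POVM $\mu$ on $n$ data qubits with $m$ ancillas such that $s_\mu=2^{-\ell}(3^{a+1}-1)^r(3^a-1)^{\ell-r}$, together with a partition of $t$ qubits into $\ell$ sets, $r$ of size $a+1$ and $\ell-r$ of size $a$, and a maximal Abelian group $\mathcal S$ of $(n+t)$-qubit Pauli strings (modulo phases) with common eigenbasis $(\Phi'_b)_b$, with the following properties. No nontrivial element of $\mathcal S$ acts trivially on the last $t$ qubits. The elements of $\mathcal S$ that act trivially on the first $n$ qubits form the group generated by the $\ell$ strings that act on the $t$ qubits as $X\cdots XZ$ on one set of the partition ($Z$ on its last qubit, $X$ on its other qubits) and trivially elsewhere. Finally, $\mu$ has the same linear span as the operators $(I\otimes\langle T|^{\otimes t})\,|\Phi'_b\rangle\langle\Phi'_b|\,(I\otimes|T\rangle^{\otimes t})$, where $|T\rangle=(|0\rangle+e^{i\pi/4}|1\rangle)/\sqrt2$. -/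

import Mathlib

/-! ### Qubit registers and Pauli strings

A register of qubits is indexed by a finite type `ι`; its computational basis is `ι → Fin 2`. -/

/-- The Hilbert space of the qubits indexed by `ι`. -/
abbrev QSpace (ι : Type) : Type := EuclideanSpace ℂ (ι → Fin 2)

/-- Operators on the Hilbert space of the qubits indexed by `ι`. -/
abbrev QOp (ι : Type) : Type := Matrix (ι → Fin 2) (ι → Fin 2) ℂ

/-- A Pauli string modulo phases: `(0,0), (1,0), (1,1), (0,1)` stand for the letters `I, X, Y, Z`.
Multiplication of Pauli strings modulo phases is addition here. -/
abbrev PauliString (ι : Type) : Type := ι → ZMod 2 × ZMod 2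

noncomputable section

/-- The one-qubit Pauli matrices `I, X, Y, Z`. -/
def pauliMatrix (p : ZMod 2 × ZMod 2) : Matrix (Fin 2) (Fin 2) ℂ :=
  if p = (0, 0) then 1
  else if p = (1, 0) then !![0, 1; 1, 0]
  else if p = (1, 1) then !![0, -Complex.I; Complex.I, 0]
  else !![1, 0; 0, -1]

/-- The Hermitian operator (tensor product of Pauli matrices) of a Pauli string. -/
def pauliOp {ι : Type} [Fintype ι] (g : PauliString ι) : QOp ι :=
  Matrix.of fun s s' => ∏ k, pauliMatrix (g k) (s k) (s' k)

/-- The rank-one operator `|ψ⟩⟨ψ|`. -/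
def ketbra {ι : Type} (ψ : QSpace ι) : QOp ι :=
  Matrix.of fun s s' => ψ s * star (ψ s')

/-! ### Stabilizer formalism -/

/-- Stabilizer groups modulo phases: maximal Abelian subgroups, i.e. groups of Pauli strings whose
operators commute and which contain every string commuting with all of their elements. -/
def IsStabilizerGroup {ι : Type} [Fintype ι] [DecidableEq ι]
    (S : AddSubgroup (PauliString ι)) : Prop :=
  (∀ g ∈ S, ∀ h ∈ S, Commute (pauliOp g) (pauliOp h)) ∧
    ∀ g : PauliString ι, (∀ h ∈ S, Commute (pauliOp g) (pauliOp h)) → g ∈ S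

/-- `ψ` is a common eigenvector of the strings in `S`; since the operators of the strings square to
the identity, the eigenvalues are `±1`. -/
def IsCommonEigenvector {ι : Type} [Fintype ι] [DecidableEq ι] (S : AddSubgroup (PauliString ι))
    (ψ : QSpace ι) : Prop :=
  ∀ g ∈ S, (pauliOp g).mulVec ψ.ofLp = ψ.ofLp ∨ (pauliOp g).mulVec ψ.ofLp = -ψ.ofLp

/-- Stabilizer states: unit vectors that are fixed, for each `g` of some stabilizer group modulo
phases, by `g` or by `-g`. -/
def IsStabilizerState {ι : Type} [Fintype ι] [DecidableEq ι] (ψ : QSpace ι) : Prop :=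
  ‖ψ‖ = 1 ∧ ∃ S : AddSubgroup (PauliString ι), IsStabilizerGroup S ∧ IsCommonEigenvector S ψ

/-- `Φ` is the stabilizer basis of the stabilizer group `S` modulo phases. -/
def IsStabilizerBasisOf {ι : Type} [Fintype ι] [DecidableEq ι] (S : AddSubgroup (PauliString ι))
    (Φ : OrthonormalBasis (ι → Fin 2) ℂ (QSpace ι)) : Prop :=
  IsStabilizerGroup S ∧ ∀ b, IsCommonEigenvector S (Φ b)

/-- Stabilizer bases. -/
def IsStabilizerBasis {ι : Type} [Fintype ι] [DecidableEq ι]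
    (Φ : OrthonormalBasis (ι → Fin 2) ℂ (QSpace ι)) : Prop :=
  ∃ S : AddSubgroup (PauliString ι), IsStabilizerBasisOf S Φ

/-- Clifford unitaries: unitaries that map the Pauli group (with phases `±1, ±i`) to itself by
conjugation. -/
def IsClifford {ι : Type} [Fintype ι] [DecidableEq ι] (U : QOp ι) : Prop :=
  U ∈ Matrix.unitaryGroup (ι → Fin 2) ℂ ∧
    ∀ g : PauliString ι, ∃ (c : ℂ) (h : PauliString ι), c ^ 4 = 1 ∧
      U * pauliOp g * U.conjTranspose = c • pauliOp h

/-! ### `t`-doped circuits and their effective POVMs -/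

/-- The gate `T = diag(1, e^{iπ/4})` on qubit `k`. -/
def tGate {ι : Type} [Fintype ι] (k : ι) : QOp ι :=
  Matrix.diagonal fun s => if s k = 1 then Complex.exp (Complex.I * (Real.pi / 4)) else 1

/-- Unitaries of circuits that consist of Clifford unitaries and exactly `t` gates `T`. -/
inductive IsDoped {ι : Type} [Fintype ι] [DecidableEq ι] : ℕ → QOp ι → Prop
  | clifford (C : QOp ι) (hC : IsClifford C) : IsDoped 0 C
  | step (t : ℕ) (U C : QOp ι) (k : ι) (hU : IsDoped t U) (hC : IsClifford C) :
      IsDoped (t + 1) (C * tGate k * U)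

/-- The operator `I ⊗ ρ` on the register `ι ⊕ κ`. -/
def idTensor {ι κ : Type} [Fintype ι] (ρ : QOp κ) : QOp (ι ⊕ κ) :=
  Matrix.of fun s s' =>
    if s ∘ Sum.inl = s' ∘ Sum.inl then ρ (s ∘ Sum.inr) (s' ∘ Sum.inr) else 0

/-- The partial trace over the register `κ`. -/
def partialTrace {ι κ : Type} [Fintype κ] [DecidableEq κ] (M : QOp (ι ⊕ κ)) : QOp ι :=
  Matrix.of fun s s' => ∑ e : κ → Fin 2, M (Sum.elim s e) (Sum.elim s' e)

/-- The effective POVM `μ_b = Tr_κ[U† |Φ_b⟩⟨Φ_b| U (I ⊗ |ψ⟩⟨ψ|)]` on the data qubits `ι`, for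
ancillas `κ` in the state `ψ`, evolution `U` and measurement basis `Φ`. -/
def effectivePOVM {ι κ : Type} [Fintype ι] [DecidableEq ι] [Fintype κ] [DecidableEq κ]
    (U : QOp (ι ⊕ κ)) (ψ : QSpace κ)
    (Φ : OrthonormalBasis (ι ⊕ κ → Fin 2) ℂ (QSpace (ι ⊕ κ))) : (ι ⊕ κ → Fin 2) → QOp ι :=
  fun b => partialTrace (U.conjTranspose * ketbra (Φ b) * U * idTensor (ketbra ψ))

/-- The `t`-doped POVMs on `n` data qubits with `m` ancillas. -/
def IsDopedPOVM (n m t : ℕ) (μ : (Fin n ⊕ Fin m → Fin 2) → QOp (Fin n)) : Prop :=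
  ∃ (U : QOp (Fin n ⊕ Fin m)) (ψ : QSpace (Fin m))
    (Φ : OrthonormalBasis (Fin n ⊕ Fin m → Fin 2) ℂ (QSpace (Fin n ⊕ Fin m))),
    IsDoped t U ∧ IsStabilizerState ψ ∧ IsStabilizerBasis Φ ∧ μ = effectivePOVM U ψ Φ

/-- The linear span of the elements of a POVM. -/
def povmSpan {ι β : Type} (μ : β → QOp ι) : Submodule ℂ (QOp ι) :=
  Submodule.span ℂ (Set.range μ)

/-- The number `s_μ`: the dimension of the linear span of the elements of `μ`. -/
def povmDim {ι β : Type} (μ : β → QOp ι) : ℕ :=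
  Module.finrank ℂ (povmSpan μ)

/-! ### Data of the explicit constructions -/

/-- The product `|T⟩^{⊗κ}` of the magic states `|T⟩ = (|0⟩ + e^{iπ/4}|1⟩)/√2`. -/
def magicState (κ : Type) [Fintype κ] : QSpace κ :=
  WithLp.toLp 2 fun s => ∏ k, (if s k = 1 then Complex.exp (Complex.I * (Real.pi / 4)) else 1) /
    (Real.sqrt 2 : ℂ)

/-- The string `X⋯XZ` with support `B`: `Z` on the last qubit of `B`, `X` on the other qubits
of `B`, `I` elsewhere. -/
def xxzString {t : ℕ} (B : Finset (Fin t)) : PauliString (Fin t) :=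
  fun k => if k ∈ B then (if ∀ j ∈ B, j ≤ k then (0, 1) else (1, 0)) else (0, 0)

/-- The lower bound `2^{-ℓ} (3^{a+1} - 1)^r (3^a - 1)^{ℓ - r}`. -/
def dopedBound (ℓ a r : ℕ) : ℝ :=
  ((2 : ℝ) ^ ℓ)⁻¹ * ((3 : ℝ) ^ (a + 1) - 1) ^ r * ((3 : ℝ) ^ a - 1) ^ (ℓ - r)

end

/-! Conjugated by Clifford unitaries, a `T` gate becomes, up to a phase, the rotation
`exp (-iπP/8)` about any nontrivial Pauli string `P`. For an ancilla state `ψ`, consider the map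
`M ↦ Tr_κ[U† M U (I ⊗ |ψ⟩⟨ψ|)]`. If `U` consists of rotations about ancilla strings, the image of a
Pauli string is a multiple of its data part, so the span of the POVM of a stabilizer basis is
spanned by Pauli strings: the data parts of the elements of the stabilizer group with nonzero image.

Take an ancilla copy of each data qubit, with all ancillas in the state `|+⟩`. The `n` rotations
about `Z` on the copies kill exactly the strings with a letter `Z` on the copies. Divide the copies
into `ℓ` blocks; the `ℓ` rotations about `X⋯X` on a block mix a string anticommuting with `X⋯X` and
its product with `X⋯X`, in which `Y` and `Z` are exchanged. So the strings whose restriction to a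
block has no letter `Y` and an odd number of letters `Z` survive as well. (For
an empty block, a rotation about `X` on an ancilla in the state `|+⟩` uses up the gate without
effect.) The Bell measurement of each data qubit with its copy transfers the surviving strings to
the data register. A block of `k` data qubits contributes the factor
`3^k + (3^k - 1)/2 = (3^(k+1) - 1)/2`. When the data qubits are distributed evenly, the numbers
`k + 1`, whose sum is `n + ℓ = t`, are `a + 1` for `r` blocks and `a` for the others.

In the form with `t` magic states, block `i` gets a further qubit, its head. The strings
`p ⊗ (p + A) ⊗ (c, A)` form a maximal Abelian group, where `A` is one bit per block, added as `X` on
the copies and as `Z` on the head, and `c` is the parity of the number of letters `Y` and `Z` of `p`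
in the block, added as `X` on the head. The expectation value of a Pauli letter in `|T⟩` vanishes
exactly for `Z`, so the same data strings survive. -/

open Matrix

section PauliAlgebra

/-- The tensor product of one-qubit operators. -/
def tensorOp {ι : Type} [Fintype ι] (M : ι → Matrix (Fin 2) (Fin 2) ℂ) : QOp ι :=
  Matrix.of fun s s' => ∏ k, M k (s k) (s' k)

/-- The character `x ↦ (-1) ^ x` of `ZMod 2`. -/
noncomputable def pauliSign : AddChar (ZMod 2) ℂ :=
  AddChar.zmodChar 2 (show (-1 : ℂ) ^ 2 = 1 by norm_num)

/-- The symplectic form on Pauli letters. -/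
def letterForm (p q : ZMod 2 × ZMod 2) : ZMod 2 := p.1 * q.2 + p.2 * q.1

/-- The symplectic form on Pauli strings: `0` for commuting and `1` for anticommuting strings. -/
def sympForm {ι : Type} [Fintype ι] :
    PauliString ι →ₗ[ZMod 2] PauliString ι →ₗ[ZMod 2] ZMod 2 :=
  LinearMap.mk₂ (ZMod 2) (fun g h => ∑ k, letterForm (g k) (h k))
    (fun g g' h => by
      simp only [letterForm, Pi.add_apply, Prod.fst_add, Prod.snd_add, ← Finset.sum_add_distrib]
      exact Finset.sum_congr rfl fun _ _ => by ring)
    (fun c g h => by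
      simp only [letterForm, Pi.smul_apply, Prod.smul_fst, Prod.smul_snd, smul_eq_mul,
        Finset.mul_sum]
      exact Finset.sum_congr rfl fun _ _ => by ring)
    (fun g h h' => by
      simp only [letterForm, Pi.add_apply, Prod.fst_add, Prod.snd_add, ← Finset.sum_add_distrib]
      exact Finset.sum_congr rfl fun _ _ => by ring)
    (fun c g h => by
      simp only [letterForm, Pi.smul_apply, Prod.smul_fst, Prod.smul_snd, smul_eq_mul,
        Finset.mul_sum]
      exact Finset.sum_congr rfl fun _ _ => by ring)

theorem zmod_two_cases (x : ZMod 2) : x = 0 ∨ x = 1 := by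
  revert x; decide

theorem pauliLetter_cases (p : ZMod 2 × ZMod 2) :
    p = (0, 0) ∨ p = (1, 0) ∨ p = (1, 1) ∨ p = (0, 1) := by
  revert p; decide

@[simp] theorem pauliSign_one : pauliSign 1 = -1 := by
  rw [pauliSign, AddChar.zmodChar_apply, ZMod.val_one, pow_one]

theorem pauliSign_sum {α : Type*} (s : Finset α) (f : α → ZMod 2) :
    pauliSign (∑ k ∈ s, f k) = ∏ k ∈ s, pauliSign (f k) :=
  map_prod pauliSign.toMonoidHom (fun k => Multiplicative.ofAdd (f k)) s

@[simp] theorem pauliMatrix_I : pauliMatrix (0, 0) = 1 := by simp [pauliMatrix]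

@[simp] theorem pauliMatrix_X : pauliMatrix (1, 0) = !![0, 1; 1, 0] := by simp [pauliMatrix]

@[simp] theorem pauliMatrix_Y : pauliMatrix (1, 1) = !![0, -Complex.I; Complex.I, 0] := by
  simp [pauliMatrix]

@[simp] theorem pauliMatrix_Z : pauliMatrix (0, 1) = !![1, 0; 0, -1] := by simp [pauliMatrix]

theorem pauliMatrix_mul (p q : ZMod 2 × ZMod 2) :
    ∃ c : ℂ, c ^ 4 = 1 ∧ pauliMatrix p * pauliMatrix q = c • pauliMatrix (p + q) := by
  have h2 : (1 : ZMod 2) + 1 = 0 := rfl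
  obtain ⟨c, hc, h⟩ : ∃ c : ℂ, (c = 1 ∨ c = Complex.I ∨ c = -Complex.I) ∧
      pauliMatrix p * pauliMatrix q = c • pauliMatrix (p + q) := by
    rcases pauliLetter_cases p with rfl | rfl | rfl | rfl <;>
      rcases pauliLetter_cases q with rfl | rfl | rfl | rfl <;>
      simp [h2, Matrix.one_fin_two]
  refine ⟨c, ?_, h⟩
  rcases hc with rfl | rfl | rfl <;> simp [Even.neg_pow (show Even 4 by decide)]

theorem pauliMatrix_mul_comm (p q : ZMod 2 × ZMod 2) :
    pauliMatrix p * pauliMatrix q =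
      pauliSign (letterForm p q) • (pauliMatrix q * pauliMatrix p) := by
  have h2 : (1 : ZMod 2) + 1 = 0 := rfl
  rcases pauliLetter_cases p with rfl | rfl | rfl | rfl <;>
    rcases pauliLetter_cases q with rfl | rfl | rfl | rfl <;>
    simp [h2, Matrix.one_fin_two, letterForm]

theorem pauliMatrix_mul_self (p : ZMod 2 × ZMod 2) : pauliMatrix p * pauliMatrix p = 1 := by
  rcases pauliLetter_cases p with rfl | rfl | rfl | rfl <;>
    simp [Matrix.one_fin_two]

theorem conjTranspose_pauliMatrix (p : ZMod 2 × ZMod 2) :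
    (pauliMatrix p)ᴴ = pauliMatrix p := by
  rcases pauliLetter_cases p with rfl | rfl | rfl | rfl
  · simp
  all_goals ext i j; fin_cases i <;> fin_cases j <;> simp

theorem trace_pauliMatrix (p : ZMod 2 × ZMod 2) :
    (pauliMatrix p).trace = if p = 0 then 2 else 0 := by
  rcases pauliLetter_cases p with rfl | rfl | rfl | rfl <;>
    simp [Matrix.trace_fin_two, Prod.ext_iff]

variable {ι : Type} [Fintype ι]

theorem pauliOp_eq_tensorOp (g : PauliString ι) :
    pauliOp g = tensorOp fun k => pauliMatrix (g k) := rfl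

theorem tensorOp_smul (c : ι → ℂ) (M : ι → Matrix (Fin 2) (Fin 2) ℂ) :
    tensorOp (fun k => c k • M k) = (∏ k, c k) • tensorOp M := by
  ext s s'
  simp [tensorOp, Finset.prod_mul_distrib]

theorem tensorOp_diagonal (d : ι → Fin 2 → ℂ) :
    tensorOp (fun k => Matrix.diagonal (d k)) = Matrix.diagonal fun s => ∏ k, d k (s k) := by
  ext s s'
  simp only [tensorOp, Matrix.of_apply, Matrix.diagonal_apply, Finset.prod_ite_zero,
    Finset.mem_univ, true_implies, funext_iff]

theorem pauliOp_zero : pauliOp (0 : PauliString ι) = 1 := by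
  have h : pauliMatrix 0 = Matrix.diagonal 1 := pauliMatrix_I
  rw [pauliOp_eq_tensorOp]
  simp only [Pi.zero_apply, h, tensorOp_diagonal, Pi.one_apply, Finset.prod_const_one]
  rfl

theorem conjTranspose_pauliOp (g : PauliString ι) : (pauliOp g)ᴴ = pauliOp g := by
  ext s s'
  simp only [Matrix.conjTranspose_apply, pauliOp, Matrix.of_apply, star_prod]
  exact Finset.prod_congr rfl fun k _ =>
    congrFun (congrFun (conjTranspose_pauliMatrix (g k)) (s k)) (s' k)

theorem sympForm_apply (g h : PauliString ι) : sympForm g h = ∑ k, letterForm (g k) (h k) := rfl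

theorem sympForm_comm (g h : PauliString ι) : sympForm g h = sympForm h g :=
  Finset.sum_congr rfl fun _ _ => by simp only [letterForm]; ring

variable [DecidableEq ι]

theorem sympForm_single (g : PauliString ι) (k : ι) (p : ZMod 2 × ZMod 2) :
    sympForm g (Pi.single k p) = letterForm (g k) p := by
  rw [sympForm_apply, Finset.sum_eq_single k]
  · rw [Pi.single_eq_same]
  · intro j _ hj; simp [hj, letterForm]
  · simp

theorem prod_sum_eq_sum_prod (f : ι → Fin 2 → ℂ) :
    ∏ k, ∑ b, f k b = ∑ s : ι → Fin 2, ∏ k, f k (s k) := by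
  rw [Finset.prod_univ_sum, Fintype.piFinset_univ]

theorem tensorOp_mul (M N : ι → Matrix (Fin 2) (Fin 2) ℂ) :
    tensorOp M * tensorOp N = tensorOp fun k => M k * N k := by
  ext s s'
  simp only [tensorOp, Matrix.mul_apply, Matrix.of_apply, prod_sum_eq_sum_prod,
    Finset.prod_mul_distrib]

theorem trace_tensorOp (M : ι → Matrix (Fin 2) (Fin 2) ℂ) :
    (tensorOp M).trace = ∏ k, (M k).trace := by
  simp only [Matrix.trace, tensorOp, prod_sum_eq_sum_prod, Matrix.diag_apply, Matrix.of_apply]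

theorem pauliOp_mul (g h : PauliString ι) :
    ∃ c : ℂ, c ^ 4 = 1 ∧ pauliOp g * pauliOp h = c • pauliOp (g + h) := by
  choose c hc hmul using fun k => pauliMatrix_mul (g k) (h k)
  refine ⟨∏ k, c k, by simp [← Finset.prod_pow, hc], ?_⟩
  simp only [pauliOp_eq_tensorOp, tensorOp_mul, hmul, tensorOp_smul, Pi.add_apply]

theorem pauliOp_mul_comm (g h : PauliString ι) :
    pauliOp g * pauliOp h = pauliSign (sympForm g h) • (pauliOp h * pauliOp g) := by
  simp only [pauliOp_eq_tensorOp, tensorOp_mul]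
  rw [sympForm_apply, pauliSign_sum, ← tensorOp_smul]
  exact congrArg _ (funext fun k => pauliMatrix_mul_comm _ _)

theorem pauliOp_mul_self (g : PauliString ι) : pauliOp g * pauliOp g = 1 := by
  simp only [← pauliOp_zero, pauliOp_eq_tensorOp, tensorOp_mul, pauliMatrix_mul_self,
    Pi.zero_apply]
  rw [← pauliMatrix_I]; rfl

theorem pauliOp_mul_mul_pauliOp (g h : PauliString ι) :
    pauliOp g * pauliOp h * pauliOp g = pauliSign (sympForm g h) • pauliOp h := by
  rw [pauliOp_mul_comm, smul_mul_assoc, mul_assoc, pauliOp_mul_self, mul_one]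

omit [DecidableEq ι] in
theorem pauliOp_ne_zero (g : PauliString ι) : pauliOp g ≠ 0 := fun h => by
  classical
  exact zero_ne_one (α := QOp ι) (by rw [← pauliOp_mul_self g, h, zero_mul])

theorem commute_pauliOp_iff (g h : PauliString ι) :
    Commute (pauliOp g) (pauliOp h) ↔ sympForm g h = 0 := by
  constructor
  · intro hc
    refine (zmod_two_cases _).resolve_right fun h1 => pauliOp_ne_zero h ?_
    have hneg : pauliOp h = -pauliOp h := by
      have := pauliOp_mul_mul_pauliOp g h
      rwa [hc.eq, mul_assoc, pauliOp_mul_self, mul_one, h1, pauliSign_one, neg_one_smul] at this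
    rw [eq_neg_iff_add_eq_zero, ← two_smul ℂ] at hneg
    exact (smul_eq_zero.mp hneg).resolve_left two_ne_zero
  · intro h0
    rw [commute_iff_eq, pauliOp_mul_comm, h0, AddChar.map_zero_eq_one, one_smul]

theorem trace_pauliOp (g : PauliString ι) :
    (pauliOp g).trace = if g = 0 then 2 ^ Fintype.card ι else 0 := by
  rw [pauliOp_eq_tensorOp, trace_tensorOp]
  simp only [trace_pauliMatrix, Finset.prod_ite_zero, Finset.mem_univ, true_implies, funext_iff,
    Pi.zero_apply, Finset.prod_const, Finset.card_univ]

theorem trace_pauliOp_mul_pauliOp (g h : PauliString ι) :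
    (pauliOp g * pauliOp h).trace = if g = h then 2 ^ Fintype.card ι else 0 := by
  rcases eq_or_ne g h with rfl | hgh
  · rw [pauliOp_mul_self, ← pauliOp_zero, trace_pauliOp, if_pos rfl, if_pos rfl]
  · obtain ⟨c, -, hc⟩ := pauliOp_mul g h
    have h0 : g + h ≠ 0 := fun h0 => hgh (add_right_cancel (h0.trans (ZModModule.add_self h).symm))
    rw [hc, Matrix.trace_smul, trace_pauliOp, if_neg h0, smul_zero, if_neg hgh]

theorem trace_pauliOp_mul_sum (h : PauliString ι) (c : PauliString ι → ℂ) :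
    (pauliOp h * ∑ g, c g • pauliOp g).trace = 2 ^ Fintype.card ι * c h := by
  simp [Finset.mul_sum, Matrix.trace_sum, trace_pauliOp_mul_pauliOp, mul_comm]

omit [DecidableEq ι] in
theorem linearIndependent_pauliOp :
    LinearIndependent ℂ (pauliOp : PauliString ι → QOp ι) := by
  classical
  rw [Fintype.linearIndependent_iff]
  intro c hc h
  have := trace_pauliOp_mul_sum h c
  rw [hc, mul_zero, Matrix.trace_zero] at this
  exact (mul_eq_zero.mp this.symm).resolve_left (by simp)

/-- The basis of the space of operators consisting of the operators of the Pauli strings. -/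
noncomputable def pauliBasis : Module.Basis (PauliString ι) ℂ (QOp ι) :=
  Module.Basis.mk linearIndependent_pauliOp
    (linearIndependent_pauliOp.span_eq_top_of_card_eq_finrank
      (by rw [Module.finrank_matrix]; simp [← mul_pow])).ge

@[simp] theorem coe_pauliBasis : ⇑(pauliBasis (ι := ι)) = pauliOp :=
  Module.Basis.coe_mk _ _

theorem trace_pauliOp_mul (h : PauliString ι) (M : QOp ι) :
    (pauliOp h * M).trace = 2 ^ Fintype.card ι * pauliBasis.repr M h := by
  conv_lhs => rw [← pauliBasis.sum_repr M, coe_pauliBasis]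
  exact trace_pauliOp_mul_sum h _

/-- Cyclicity of the trace gives `tr (h M) = tr (g h g M) = -tr (h M)`. -/
theorem pauliBasis_repr_eq_zero {M : QOp ι} {g h : PauliString ι} (hM : Commute (pauliOp g) M)
    (hgh : sympForm g h = 1) : pauliBasis.repr M h = 0 := by
  have hneg : (pauliOp h * M).trace = -(pauliOp h * M).trace :=
    calc (pauliOp h * M).trace
        = (pauliOp h * (pauliOp g * M * pauliOp g)).trace := by
          rw [hM.eq, mul_assoc M, pauliOp_mul_self, mul_one]
      _ = (pauliOp g * pauliOp h * pauliOp g * M).trace := by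
          rw [← mul_assoc, Matrix.trace_mul_comm]; simp only [mul_assoc]
      _ = -(pauliOp h * M).trace := by
          rw [pauliOp_mul_mul_pauliOp, hgh, pauliSign_one, neg_one_smul, neg_mul, Matrix.trace_neg]
  have h0 := self_eq_neg.mp hneg
  rw [trace_pauliOp_mul] at h0
  exact (mul_eq_zero.mp h0).resolve_left (by simp)

end PauliAlgebra

section StabilizerBases

theorem exists_orthonormalBasis_common_eigenvectors {𝕜 E n β : Type*} [RCLike 𝕜]
    [NormedAddCommGroup E] [InnerProductSpace 𝕜 E] [FiniteDimensional 𝕜 E] [Fintype β]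
    (hcard : Module.finrank 𝕜 E = Fintype.card β) {T : n → E →ₗ[𝕜] E}
    (hT : ∀ i, (T i).IsSymmetric) (hC : Pairwise (Function.onFun Commute T)) :
    ∃ Φ : OrthonormalBasis β 𝕜 E, ∀ b i, ∃ c : 𝕜, T i (Φ b) = c • Φ b := by
  classical
  let V : (n → 𝕜) → Submodule 𝕜 E := fun γ => ⨅ i, Module.End.eigenspace (T i) (γ i)
  have hV : OrthogonalFamily 𝕜 (fun γ => V γ) fun γ => (V γ).subtypeₗᵢ :=
    LinearMap.IsSymmetric.orthogonalFamily_iInf_eigenspaces hT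
  have hInt : DirectSum.IsInternal V :=
    LinearMap.IsSymmetric.directSum_isInternal_of_pairwise_commute hT hC
  have hfin : {γ | V γ ≠ ⊥}.Finite :=
    WellFoundedGT.finite_ne_bot_of_iSupIndep hInt.submodule_iSupIndep
  have : Fintype {γ // V γ ≠ ⊥} := hfin.fintype
  have hInt' : DirectSum.IsInternal fun γ : {γ // V γ ≠ ⊥} => V γ :=
    DirectSum.isInternal_ne_bot_iff.mpr hInt
  have hV' := hV.comp (Subtype.val_injective (p := fun γ => V γ ≠ ⊥))
  refine ⟨(hInt'.subordinateOrthonormalBasis hcard hV').reindex (Fintype.equivFin β).symm,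
    fun b i => ?_⟩
  rw [OrthonormalBasis.reindex_apply]
  exact ⟨_, Module.End.mem_eigenspace_iff.mp ((Submodule.mem_iInf _).mp
    (hInt'.subordinateOrthonormalBasis_subordinate hcard _ hV') i)⟩

theorem conjTranspose_ketbra {ι : Type} (ψ : QSpace ι) : (ketbra ψ)ᴴ = ketbra ψ := by
  ext s s'
  simp [ketbra, Matrix.conjTranspose_apply, mul_comm]

variable {ι : Type} [Fintype ι] [DecidableEq ι]

theorem mul_ketbra (M : QOp ι) (ψ : QSpace ι) :
    M * ketbra ψ = Matrix.of fun s s' => (M *ᵥ ψ.ofLp) s * star (ψ s') := by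
  ext s s'
  simp only [Matrix.mul_apply, ketbra, Matrix.of_apply, Matrix.mulVec, dotProduct,
    Finset.sum_mul, mul_assoc]

theorem sum_ketbra (Φ : OrthonormalBasis (ι → Fin 2) ℂ (QSpace ι)) :
    ∑ b, ketbra (Φ b) = 1 := by
  ext s s'
  have h := Φ.sum_inner_mul_inner (EuclideanSpace.single s (1 : ℂ)) (EuclideanSpace.single s' 1)
  simp only [EuclideanSpace.inner_single_left, EuclideanSpace.inner_single_right, map_one,
    one_mul] at h
  rw [Matrix.sum_apply]
  refine h.trans ?_
  rw [PiLp.single_apply, apply_ite (starRingEnd ℂ), map_one, map_zero, Matrix.one_apply]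
  exact if_congr eq_comm rfl rfl

theorem isStabilizerGroup_iff (S : AddSubgroup (PauliString ι)) :
    IsStabilizerGroup S ↔ ∀ g, g ∈ S ↔ ∀ h ∈ S, sympForm g h = 0 := by
  simp only [IsStabilizerGroup, commute_pauliOp_iff]
  exact ⟨fun h g => ⟨h.1 g, h.2 g⟩, fun h => ⟨fun g hg => (h g).mp hg, fun g => (h g).mpr⟩⟩

theorem mulVec_pauliOp_eq_or_eq_neg {g : PauliString ι} {c : ℂ} {v : (ι → Fin 2) → ℂ}
    (hv : pauliOp g *ᵥ v = c • v) : pauliOp g *ᵥ v = v ∨ pauliOp g *ᵥ v = -v := by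
  have hsq : (c * c - 1) • v = 0 := by
    rw [sub_smul, one_smul, mul_smul, ← hv, ← Matrix.mulVec_smul, ← hv, Matrix.mulVec_mulVec,
      pauliOp_mul_self, Matrix.one_mulVec, sub_self]
  rcases smul_eq_zero.mp hsq with hc | rfl
  · rcases mul_self_eq_one_iff.mp (sub_eq_zero.mp hc) with rfl | rfl
    · exact .inl (by rw [hv, one_smul])
    · exact .inr (by rw [hv, neg_one_smul])
  · exact .inl (Matrix.mulVec_zero _)

theorem exists_isStabilizerBasisOf {S : AddSubgroup (PauliString ι)} (hS : IsStabilizerGroup S) :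
    ∃ Φ : OrthonormalBasis (ι → Fin 2) ℂ (QSpace ι), IsStabilizerBasisOf S Φ := by
  let T : S → QSpace ι →ₗ[ℂ] QSpace ι := fun g => Matrix.toEuclideanLin (pauliOp g.1)
  have hT : ∀ g, (T g).IsSymmetric := fun g =>
    Matrix.isSymmetric_toEuclideanLin_iff.mpr (conjTranspose_pauliOp g.1)
  have hcomm : Pairwise (Function.onFun Commute T) := fun g h _ => by
    refine LinearMap.ext fun v => ?_
    simp only [T, Module.End.mul_apply, Matrix.toLpLin_apply, Matrix.mulVec_mulVec,
      (hS.1 g g.2 h h.2).eq]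
  obtain ⟨Φ, hΦ⟩ := exists_orthonormalBasis_common_eigenvectors (β := ι → Fin 2)
    (finrank_euclideanSpace (𝕜 := ℂ)) hT hcomm
  refine ⟨Φ, hS, fun b g hg => ?_⟩
  obtain ⟨c, hc⟩ := hΦ b ⟨g, hg⟩
  exact mulVec_pauliOp_eq_or_eq_neg (c := c)
    (by simpa [T, Matrix.toLpLin_apply] using congrArg WithLp.ofLp hc)

theorem pauliOp_mul_ketbra {S : AddSubgroup (PauliString ι)} {ψ : QSpace ι}
    (hψ : IsCommonEigenvector S ψ) {g : PauliString ι} (hg : g ∈ S) :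
    ∃ c : ℂ, star c = c ∧ pauliOp g * ketbra ψ = c • ketbra ψ := by
  rcases hψ g hg with h | h
  · exact ⟨1, star_one _, by rw [mul_ketbra, h, one_smul]; rfl⟩
  · refine ⟨-1, by simp, ?_⟩
    rw [mul_ketbra, h]
    ext s s'
    simp [ketbra]

theorem commute_pauliOp_ketbra {S : AddSubgroup (PauliString ι)} {ψ : QSpace ι}
    (hψ : IsCommonEigenvector S ψ) {g : PauliString ι} (hg : g ∈ S) :
    Commute (pauliOp g) (ketbra ψ) := by
  obtain ⟨c, hc, h⟩ := pauliOp_mul_ketbra hψ hg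
  have h' := congrArg Matrix.conjTranspose h
  rw [Matrix.conjTranspose_mul, Matrix.conjTranspose_smul, conjTranspose_ketbra,
    conjTranspose_pauliOp, hc] at h'
  exact h.trans h'.symm

theorem mem_span_pauliOp_of_commute {S : AddSubgroup (PauliString ι)} (hS : IsStabilizerGroup S)
    {M : QOp ι} (hM : ∀ g ∈ S, Commute (pauliOp g) M) :
    M ∈ Submodule.span ℂ (pauliOp '' (S : Set (PauliString ι))) := by
  rw [← coe_pauliBasis, Module.Basis.mem_span_image]
  intro h hh
  rw [Finset.mem_coe, Finsupp.mem_support_iff] at hh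
  refine ((isStabilizerGroup_iff S).mp hS h).mpr fun g hg => (zmod_two_cases _).resolve_right ?_
  rw [sympForm_comm]
  exact fun hgh => hh (pauliBasis_repr_eq_zero (hM g hg) hgh)

theorem span_ketbra_eq_span_pauliOp {S : AddSubgroup (PauliString ι)}
    {Φ : OrthonormalBasis (ι → Fin 2) ℂ (QSpace ι)} (h : IsStabilizerBasisOf S Φ) :
    Submodule.span ℂ (Set.range fun b => ketbra (Φ b)) =
      Submodule.span ℂ (pauliOp '' (S : Set (PauliString ι))) := by
  apply le_antisymm <;> rw [Submodule.span_le]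
  · rintro _ ⟨b, rfl⟩
    exact mem_span_pauliOp_of_commute h.1 fun g hg => commute_pauliOp_ketbra (h.2 b) hg
  · rintro _ ⟨g, hg, rfl⟩
    choose c _ hc using fun b => pauliOp_mul_ketbra (h.2 b) hg
    rw [← mul_one (pauliOp g), ← sum_ketbra Φ, Finset.mul_sum]
    simp only [hc]
    exact Submodule.sum_mem _ fun b _ => Submodule.smul_mem _ _ (Submodule.subset_span ⟨b, rfl⟩)

end StabilizerBases

section EffectiveOperators

theorem inv_sqrt_two_mul_self : ((Real.sqrt 2 : ℂ))⁻¹ * (Real.sqrt 2 : ℂ)⁻¹ = 1 / 2 := by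
  rw [← mul_inv, ← Complex.ofReal_mul, Real.mul_self_sqrt (by norm_num)]
  norm_num

/-- The phase `e^{iπ/4}` of the gate `T`. -/
noncomputable def tPhase : ℂ := Complex.exp (Complex.I * (Real.pi / 4))

theorem star_tPhase_mul : star tPhase * tPhase = 1 := by
  rw [tPhase, ← starRingEnd_apply, ← Complex.exp_conj, ← Complex.exp_add]
  simp [← Complex.ofReal_ofNat, ← Complex.ofReal_div]

theorem tPhase_sq : tPhase * tPhase = Complex.I := by
  rw [tPhase, ← Complex.exp_add, show Complex.I * (Real.pi / 4) + Complex.I * (Real.pi / 4) =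
    Real.pi / 2 * Complex.I by ring, Complex.exp_pi_div_two_mul_I]

theorem tPhase_add_star_ne_zero : tPhase + star tPhase ≠ 0 := by
  intro h
  have h1 : Complex.I + 1 = 0 := by
    linear_combination tPhase * h - tPhase_sq - star_tPhase_mul
  simpa using congrArg Complex.im h1

theorem star_sub_tPhase_ne_zero : star tPhase - tPhase ≠ 0 := by
  intro h
  have h1 : Complex.I - 1 = 0 := by
    linear_combination -tPhase * h - tPhase_sq + star_tPhase_mul
  simpa using congrArg Complex.im h1

/-- The expectation value of the one-qubit operator `M` in the state with amplitudes `v`. -/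
noncomputable def qubitExpectation (v : Fin 2 → ℂ) (M : Matrix (Fin 2) (Fin 2) ℂ) : ℂ :=
  ∑ x, ∑ y, star (v x) * M x y * v y

/-- The amplitudes of `|+⟩ = (|0⟩ + |1⟩)/√2`. -/
noncomputable def plusAmplitude : Fin 2 → ℂ := fun _ => (Real.sqrt 2 : ℂ)⁻¹

/-- The amplitudes of `|T⟩`. -/
noncomputable def magicAmplitude : Fin 2 → ℂ :=
  fun b => (if b = 1 then tPhase else 1) / (Real.sqrt 2 : ℂ)

theorem qubitExpectation_plusAmplitude (p : ZMod 2 × ZMod 2) :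
    qubitExpectation plusAmplitude (pauliMatrix p) = if p.2 = 0 then 1 else 0 := by
  have h := inv_sqrt_two_mul_self
  rcases pauliLetter_cases p with rfl | rfl | rfl | rfl <;>
    simp [qubitExpectation, plusAmplitude, Fin.sum_univ_two, Complex.conj_ofReal, h]
  all_goals ring_nf

theorem qubitExpectation_magicAmplitude (M : Matrix (Fin 2) (Fin 2) ℂ) :
    qubitExpectation magicAmplitude M =
      (M 0 0 + M 0 1 * tPhase + star tPhase * M 1 0 + M 1 1) / 2 := by
  have hs : star (Real.sqrt 2 : ℂ)⁻¹ = (Real.sqrt 2 : ℂ)⁻¹ := by simp [Complex.conj_ofReal]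
  simp only [qubitExpectation, magicAmplitude, Fin.sum_univ_two, div_eq_mul_inv, star_mul', hs]
  simp only [zero_ne_one, if_true, if_false, star_one]
  linear_combination (M 0 0 + M 0 1 * tPhase + star tPhase * M 1 0 +
    star tPhase * tPhase * M 1 1) * inv_sqrt_two_mul_self + 1 / 2 * M 1 1 * star_tPhase_mul

theorem qubitExpectation_magicAmplitude_ne_zero (p : ZMod 2 × ZMod 2) :
    qubitExpectation magicAmplitude (pauliMatrix p) ≠ 0 ↔ p ≠ (0, 1) := by
  rw [qubitExpectation_magicAmplitude]
  rcases pauliLetter_cases p with rfl | rfl | rfl | rfl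
  · simp
  · simpa using tPhase_add_star_ne_zero
  · have h := mul_ne_zero Complex.I_ne_zero star_sub_tPhase_ne_zero
    rw [show Complex.I * (star tPhase - tPhase) =
      -(Complex.I * tPhase) + star tPhase * Complex.I by ring] at h
    simpa using h
  · simp

/-- The product state with the same amplitudes on each qubit. -/
noncomputable def productState (κ : Type) [Fintype κ] (v : Fin 2 → ℂ) : QSpace κ :=
  WithLp.toLp 2 fun s => ∏ k, v (s k)

variable {ι κ : Type} [Fintype ι] [DecidableEq ι] [Fintype κ] [DecidableEq κ]

theorem tensorOp_mulVec_productState (M : κ → Matrix (Fin 2) (Fin 2) ℂ) (v : Fin 2 → ℂ)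
    (hM : ∀ k, M k *ᵥ v = v) :
    tensorOp M *ᵥ (productState κ v).ofLp = (productState κ v).ofLp := by
  funext s
  calc ∑ s' : κ → Fin 2, (∏ k, M k (s k) (s' k)) * ∏ k, v (s' k)
      = ∏ k, (M k *ᵥ v) (s k) := by
        simp only [Matrix.mulVec, dotProduct, prod_sum_eq_sum_prod, Finset.prod_mul_distrib]
    _ = ∏ k, v (s k) := by simp only [hM]

theorem expectation_productState (v : Fin 2 → ℂ) (e : PauliString κ) :
    ∑ x, ∑ y, star (productState κ v x) * pauliOp e x y * productState κ v y =
      ∏ k, qubitExpectation v (pauliMatrix (e k)) := by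
  simp only [qubitExpectation, prod_sum_eq_sum_prod, productState, pauliOp, Matrix.of_apply,
    star_prod, Finset.prod_mul_distrib]

theorem partialTrace_pauliOp_mul (g : PauliString (ι ⊕ κ)) (ψ : QSpace κ) :
    partialTrace (pauliOp g * idTensor (ketbra ψ)) =
      (∑ x, ∑ y, star (ψ x) * pauliOp (g ∘ Sum.inr) x y * ψ y) • pauliOp (g ∘ Sum.inl) := by
  ext s s'
  simp only [partialTrace, Matrix.of_apply, Matrix.mul_apply, Matrix.smul_apply, smul_eq_mul,
    Finset.sum_mul]
  refine Finset.sum_congr rfl fun x _ => ?_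
  rw [← (Equiv.sumArrowEquivProdArrow ι κ (Fin 2)).symm.sum_comp, Fintype.sum_prod_type,
    Finset.sum_eq_single s']
  · refine Finset.sum_congr rfl fun y _ => ?_
    simp [Equiv.sumArrowEquivProdArrow, idTensor, pauliOp, ketbra, Fintype.prod_sum_type]
    ring
  · intro u _ hu
    refine Finset.sum_eq_zero fun y _ => ?_
    simp [Equiv.sumArrowEquivProdArrow, idTensor, hu]
  · simp

/-- The effective operator on the data qubits of an operator on the whole register, for the
ancilla state `ψ` and the evolution `U`. -/
noncomputable def effectiveOp (U : QOp (ι ⊕ κ)) (ψ : QSpace κ) : QOp (ι ⊕ κ) →ₗ[ℂ] QOp ι where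
  toFun M := partialTrace (Uᴴ * M * U * idTensor (ketbra ψ))
  map_add' M N := by
    ext s s'
    simp [mul_add, add_mul, partialTrace, Finset.sum_add_distrib]
  map_smul' c M := by
    ext s s'
    simp [partialTrace, Finset.mul_sum]

theorem effectiveOp_mul (U V : QOp (ι ⊕ κ)) (ψ : QSpace κ) (M : QOp (ι ⊕ κ)) :
    effectiveOp (V * U) ψ M = effectiveOp U ψ (Vᴴ * M * V) := by
  simp [effectiveOp, Matrix.conjTranspose_mul, mul_assoc]

theorem effectiveOp_one_productState (v : Fin 2 → ℂ) (g : PauliString (ι ⊕ κ)) :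
    effectiveOp 1 (productState κ v) (pauliOp g) =
      (∏ k, qubitExpectation v (pauliMatrix (g (Sum.inr k)))) • pauliOp (g ∘ Sum.inl) := by
  have h := partialTrace_pauliOp_mul g (productState κ v)
  rw [expectation_productState] at h
  simpa [effectiveOp] using h

theorem povmSpan_effectivePOVM (U : QOp (ι ⊕ κ)) (ψ : QSpace κ)
    {S : AddSubgroup (PauliString (ι ⊕ κ))}
    {Φ : OrthonormalBasis (ι ⊕ κ → Fin 2) ℂ (QSpace (ι ⊕ κ))} (h : IsStabilizerBasisOf S Φ) :
    povmSpan (effectivePOVM U ψ Φ) = Submodule.span ℂ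
      ((fun g => effectiveOp U ψ (pauliOp g)) '' (S : Set (PauliString (ι ⊕ κ)))) := by
  have h1 := congrArg (Submodule.map (effectiveOp U ψ)) (span_ketbra_eq_span_pauliOp h)
  rw [Submodule.map_span, Submodule.map_span, ← Set.range_comp, Set.image_image] at h1
  exact h1

/-- The effective operator of every Pauli string is a multiple of the data part of the string, and
the factor is nonzero exactly if the ancilla part of the string satisfies `N`. -/
def HasEffectiveSupport (U : QOp (ι ⊕ κ)) (ψ : QSpace κ) (N : PauliString κ → Prop) : Prop :=
  ∀ g : PauliString (ι ⊕ κ), ∃ c : ℂ,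
    effectiveOp U ψ (pauliOp g) = c • pauliOp (g ∘ Sum.inl) ∧ (c ≠ 0 ↔ N (g ∘ Sum.inr))

theorem HasEffectiveSupport.congr {U : QOp (ι ⊕ κ)} {ψ : QSpace κ} {N N' : PauliString κ → Prop}
    (h : HasEffectiveSupport U ψ N) (hN : ∀ e, N e ↔ N' e) : HasEffectiveSupport U ψ N' := by
  rwa [← funext fun e => propext (hN e)]

theorem HasEffectiveSupport.povmSpan_eq {U : QOp (ι ⊕ κ)} {ψ : QSpace κ}
    {S : AddSubgroup (PauliString (ι ⊕ κ))}
    {Φ : OrthonormalBasis (ι ⊕ κ → Fin 2) ℂ (QSpace (ι ⊕ κ))} (h : IsStabilizerBasisOf S Φ)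
    {N : PauliString κ → Prop} (hU : HasEffectiveSupport U ψ N) :
    povmSpan (effectivePOVM U ψ Φ) = Submodule.span ℂ
      (pauliOp '' {p | ∃ g ∈ S, g ∘ Sum.inl = p ∧ N (g ∘ Sum.inr)}) := by
  rw [povmSpan_effectivePOVM U ψ h]
  apply le_antisymm <;> rw [Submodule.span_le]
  · rintro _ ⟨g, hg, rfl⟩
    obtain ⟨c, hc, hN⟩ := hU g
    simp only [hc]
    by_cases h0 : c = 0
    · rw [h0, zero_smul]; exact zero_mem _
    · exact Submodule.smul_mem _ _ (Submodule.subset_span ⟨_, ⟨g, hg, rfl, hN.mp h0⟩, rfl⟩)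
  · rintro _ ⟨_, ⟨g, hg, rfl, hN⟩, rfl⟩
    obtain ⟨c, hc, hcN⟩ := hU g
    rw [← inv_smul_smul₀ (hcN.mpr hN) (pauliOp (g ∘ Sum.inl)), ← hc]
    exact Submodule.smul_mem _ _ (Submodule.subset_span ⟨g, hg, rfl⟩)

theorem hasEffectiveSupport_one_plus :
    HasEffectiveSupport (1 : QOp (ι ⊕ κ)) (productState κ plusAmplitude)
      fun e => ∀ k, (e k).2 = 0 := by
  intro g
  refine ⟨_, effectiveOp_one_productState plusAmplitude g, ?_⟩
  simp [qubitExpectation_plusAmplitude, Finset.prod_ite_zero]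

theorem hasEffectiveSupport_one_magic :
    HasEffectiveSupport (1 : QOp (ι ⊕ κ)) (magicState κ) fun e => ∀ k, e k ≠ (0, 1) := by
  intro g
  refine ⟨_, effectiveOp_one_productState magicAmplitude g, ?_⟩
  rw [Finset.prod_ne_zero_iff]
  simp only [qubitExpectation_magicAmplitude_ne_zero, Finset.mem_univ, true_implies,
    Function.comp_apply]

/-- The group of the strings in the letters `I` and `X`, which stabilizes `|+⟩^{⊗κ}`. -/
def xGroup (κ : Type) : AddSubgroup (PauliString κ) where
  carrier := {g | ∀ k, (g k).2 = 0}
  add_mem' hg hh k := by simp [hg k, hh k]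
  zero_mem' _ := rfl
  neg_mem' hg k := by simp [hg k]

theorem isStabilizerGroup_xGroup : IsStabilizerGroup (xGroup κ) := by
  refine (isStabilizerGroup_iff _).mpr fun g => ⟨fun hg h hh => ?_, fun hg k => ?_⟩
  · exact Finset.sum_eq_zero fun k _ => by simp [letterForm, hg k, hh k]
  · have hX : Pi.single k (1, 0) ∈ xGroup κ := fun j => by
      rcases eq_or_ne j k with rfl | hj <;> simp [*]
    simpa [sympForm_single, letterForm] using hg _ hX

theorem norm_productState_plusAmplitude : ‖productState κ plusAmplitude‖ = 1 := by
  have h2 : ‖(Real.sqrt 2 : ℂ)⁻¹‖ ^ 2 = 1 / 2 := by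
    rw [norm_inv, Complex.norm_real, Real.norm_of_nonneg (Real.sqrt_nonneg 2), inv_pow,
      Real.sq_sqrt (by norm_num), one_div]
  refine (pow_eq_one_iff_of_nonneg (norm_nonneg _) two_ne_zero).mp ?_
  rw [EuclideanSpace.norm_sq_eq]
  simp only [productState, plusAmplitude, Finset.prod_const, Finset.sum_const, norm_pow]
  rw [← pow_mul, mul_comm _ 2, pow_mul, h2]
  simp

theorem pauliMatrix_mulVec_plusAmplitude {p : ZMod 2 × ZMod 2} (hp : p.2 = 0) :
    pauliMatrix p *ᵥ plusAmplitude = plusAmplitude := by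
  rcases pauliLetter_cases p with rfl | rfl | rfl | rfl
  · simp
  · funext x
    fin_cases x <;> simp [plusAmplitude, Matrix.mulVec, dotProduct]
  all_goals simp at hp

theorem isStabilizerState_plus : IsStabilizerState (productState κ plusAmplitude) :=
  ⟨norm_productState_plusAmplitude, xGroup κ, isStabilizerGroup_xGroup, fun _ hg =>
    .inl (tensorOp_mulVec_productState _ _ fun k => pauliMatrix_mulVec_plusAmplitude (hg k))⟩

end EffectiveOperators

section Rotations

theorem add_smul_mul_add_smul {A : Type*} [Ring A] [Algebra ℂ A] {p : A} (hp : p * p = 1)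
    (a b c d : ℂ) : (a • (1 : A) + b • p) * (c • (1 : A) + d • p) =
      (a * c + b * d) • (1 : A) + (a * d + b * c) • p := by
  simp only [mul_add, add_mul, smul_mul_smul_comm, mul_one, one_mul, hp]
  module

variable {ι : Type} [Fintype ι]

theorem sympForm_self (g : PauliString ι) : sympForm g g = 0 := by
  have h : ∀ p : ZMod 2 × ZMod 2, letterForm p p = 0 := by decide
  simp [sympForm_apply, h]

/-- The gate `T` with the Pauli string `P` in place of `Z`. -/
noncomputable def pauliRotation [DecidableEq ι] (P : PauliString ι) : QOp ι :=
  ((1 + tPhase) / 2) • (1 : QOp ι) + ((1 - tPhase) / 2) • pauliOp P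

/-- The reflection `(P + Q)/√2`, which exchanges the anticommuting strings `P` and `Q` by
conjugation. -/
noncomputable def pauliExchange (P Q : PauliString ι) : QOp ι :=
  (Real.sqrt 2 : ℂ)⁻¹ • (pauliOp P + pauliOp Q)

theorem conjTranspose_pauliExchange (P Q : PauliString ι) :
    (pauliExchange P Q)ᴴ = pauliExchange P Q := by
  simp [pauliExchange, Matrix.conjTranspose_smul, conjTranspose_pauliOp, Complex.conj_ofReal]

variable [DecidableEq ι]

theorem conjTranspose_pauliRotation (P : PauliString ι) :
    (pauliRotation P)ᴴ =
      ((1 + star tPhase) / 2) • (1 : QOp ι) + ((1 - star tPhase) / 2) • pauliOp P := by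
  simp [pauliRotation, Matrix.conjTranspose_smul, conjTranspose_pauliOp]

theorem pauliRotation_conj (P g : PauliString ι) :
    (pauliRotation P)ᴴ * pauliOp g * pauliRotation P =
      pauliOp g * ((((1 + star tPhase) / 2) • (1 : QOp ι) +
        (pauliSign (sympForm P g) * ((1 - star tPhase) / 2)) • pauliOp P) * pauliRotation P) := by
  rw [conjTranspose_pauliRotation, ← mul_assoc]
  congr 1
  simp only [add_mul, mul_add, smul_mul_assoc, mul_smul_comm, one_mul, mul_one]
  rw [pauliOp_mul_comm P g, smul_smul, mul_comm]

theorem pauliRotation_conj_of_commute {P g : PauliString ι} (h : sympForm P g = 0) :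
    (pauliRotation P)ᴴ * pauliOp g * pauliRotation P = pauliOp g := by
  rw [pauliRotation_conj, h, pauliRotation, add_smul_mul_add_smul (pauliOp_mul_self P)]
  have h1 := star_tPhase_mul
  rw [AddChar.map_zero_eq_one, show (1 + star tPhase) / 2 * ((1 + tPhase) / 2) +
      1 * ((1 - star tPhase) / 2) * ((1 - tPhase) / 2) = 1 by linear_combination (1 / 2 : ℂ) * h1,
    show (1 + star tPhase) / 2 * ((1 - tPhase) / 2) +
      1 * ((1 - star tPhase) / 2) * ((1 + tPhase) / 2) = 0 by linear_combination (-1 / 2 : ℂ) * h1]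
  simp

theorem pauliRotation_conj_of_anticommute {P g : PauliString ι} (h : sympForm P g = 1) :
    (pauliRotation P)ᴴ * pauliOp g * pauliRotation P =
      ((tPhase + star tPhase) / 2) • pauliOp g +
        ((star tPhase - tPhase) / 2) • (pauliOp g * pauliOp P) := by
  rw [pauliRotation_conj, h, pauliRotation, add_smul_mul_add_smul (pauliOp_mul_self P)]
  rw [pauliSign_one, show (1 + star tPhase) / 2 * ((1 + tPhase) / 2) +
      -1 * ((1 - star tPhase) / 2) * ((1 - tPhase) / 2) = (tPhase + star tPhase) / 2 by ring,
    show (1 + star tPhase) / 2 * ((1 - tPhase) / 2) +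
      -1 * ((1 - star tPhase) / 2) * ((1 + tPhase) / 2) = (star tPhase - tPhase) / 2 by ring]
  simp [mul_add]

theorem pauliOp_single_Z (k : ι) : pauliOp (Pi.single k (0, 1) : PauliString ι) =
    Matrix.diagonal fun s => if s k = 1 then -1 else 1 := by
  have h : (fun j => pauliMatrix ((Pi.single k (0, 1) : PauliString ι) j)) =
      fun j => Matrix.diagonal fun b => if j = k ∧ b = 1 then -1 else 1 := by
    funext j
    rcases eq_or_ne j k with rfl | hj
    · rw [Pi.single_eq_same, pauliMatrix_Z]
      ext a b; fin_cases a <;> fin_cases b <;> simp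
    · rw [Pi.single_eq_of_ne hj]
      simp only [hj, false_and, if_false]
      exact pauliMatrix_I.trans Matrix.diagonal_one.symm
  rw [pauliOp_eq_tensorOp, h, tensorOp_diagonal]
  congr 1
  funext s
  rw [Finset.prod_eq_single k (fun j _ hj => by simp [hj]) (by simp)]
  simp

theorem tGate_eq_pauliRotation (k : ι) :
    tGate k = pauliRotation (Pi.single k (0, 1) : PauliString ι) := by
  rw [pauliRotation, pauliOp_single_Z, tGate, ← tPhase]
  ext s s'
  by_cases h : s = s'
  · subst h
    simp only [Matrix.diagonal_apply_eq, Matrix.add_apply, Matrix.smul_apply, Matrix.one_apply_eq,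
      smul_eq_mul]
    split_ifs <;> ring
  · simp [h]

theorem pauliExchange_conj {P Q : PauliString ι} (h : sympForm P Q = 1) (g : PauliString ι) :
    pauliExchange P Q * pauliOp g * pauliExchange P Q =
      ((pauliSign (sympForm P g) + pauliSign (sympForm Q g)) / 2) • pauliOp g +
      ((pauliSign (sympForm P g) - pauliSign (sympForm Q g)) / 2) •
        (pauliOp g * (pauliOp P * pauliOp Q)) := by
  have hQP : pauliOp Q * pauliOp P = -(pauliOp P * pauliOp Q) := by
    rw [pauliOp_mul_comm P Q, h]; simp
  simp only [pauliExchange, smul_mul_assoc, mul_smul_comm, smul_smul, inv_sqrt_two_mul_self]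
  rw [add_mul, pauliOp_mul_comm P g, pauliOp_mul_comm Q g]
  simp only [add_mul, mul_add, smul_mul_assoc, mul_assoc, pauliOp_mul_self, hQP, mul_one, mul_neg]
  module

theorem pauliExchange_mul_self {P Q : PauliString ι} (h : sympForm P Q = 1) :
    pauliExchange P Q * pauliExchange P Q = 1 := by
  simpa [pauliOp_zero] using pauliExchange_conj h 0

theorem isClifford_one : IsClifford (1 : QOp ι) :=
  ⟨one_mem _, fun g => ⟨1, g, by simp, by simp⟩⟩

theorem IsClifford.mul {C D : QOp ι} (hC : IsClifford C) (hD : IsClifford D) :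
    IsClifford (C * D) := by
  refine ⟨mul_mem hC.1 hD.1, fun g => ?_⟩
  obtain ⟨c, h, hc, hh⟩ := hD.2 g
  obtain ⟨d, k, hd, hk⟩ := hC.2 h
  refine ⟨c * d, k, by rw [mul_pow, hc, hd, one_mul], ?_⟩
  calc C * D * pauliOp g * (C * D)ᴴ = C * (D * pauliOp g * Dᴴ) * Cᴴ := by
        simp only [Matrix.conjTranspose_mul, mul_assoc]
    _ = (c * d) • pauliOp k := by
        rw [hh, mul_smul_comm, smul_mul_assoc, hk, smul_smul]

theorem isClifford_pauliExchange {P Q : PauliString ι} (h : sympForm P Q = 1) :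
    IsClifford (pauliExchange P Q) := by
  constructor
  · rw [Matrix.mem_unitaryGroup_iff, Matrix.star_eq_conjTranspose, conjTranspose_pauliExchange,
      pauliExchange_mul_self h]
  · intro g
    rw [conjTranspose_pauliExchange, pauliExchange_conj h]
    obtain ⟨c, hc, hc'⟩ := pauliOp_mul P Q
    obtain ⟨d, hd, hd'⟩ := pauliOp_mul g (P + Q)
    rw [hc', mul_smul_comm, hd', smul_smul, smul_smul]
    have h4 : Even 4 := by decide
    rcases zmod_two_cases (sympForm P g) with h1 | h1 <;>
      rcases zmod_two_cases (sympForm Q g) with h2 | h2 <;> rw [h1, h2]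
    · exact ⟨1, g, by simp, by norm_num⟩
    · exact ⟨c * d, _, by rw [mul_pow, hc, hd, one_mul], by norm_num; rfl⟩
    · exact ⟨-(c * d), _, by rw [h4.neg_pow, mul_pow, hc, hd, one_mul], by norm_num; rfl⟩
    · exact ⟨-1, g, by norm_num, by norm_num⟩

theorem pauliRotation_eq_exchange {P Q : PauliString ι} (h : sympForm P Q = 1) :
    pauliRotation P = pauliExchange P Q * pauliRotation Q * pauliExchange P Q := by
  have h1 := pauliExchange_conj h Q
  rw [h, sympForm_self, pauliSign_one, AddChar.map_zero_eq_one, ← mul_assoc, pauliOp_mul_comm Q P,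
    sympForm_comm, h, pauliSign_one] at h1
  simp only [smul_mul_assoc, mul_assoc, pauliOp_mul_self] at h1
  simp only [pauliRotation, mul_add, add_mul, mul_smul_comm, smul_mul_assoc, mul_one, mul_assoc,
    pauliExchange_mul_self h, h1]
  norm_num

theorem IsDoped.clifford_mul {t : ℕ} {U C : QOp ι} (hU : IsDoped t U) (hC : IsClifford C) :
    IsDoped t (C * U) := by
  cases hU with
  | clifford D hD => exact .clifford _ (hC.mul hD)
  | step s V D k hV hD =>
    rw [mul_assoc D, ← mul_assoc C, ← mul_assoc]
    exact .step s V _ k hV (hC.mul hD)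

theorem IsDoped.pauliRotation_single_Z_mul {t : ℕ} {U : QOp ι} (hU : IsDoped t U) (k : ι) :
    IsDoped (t + 1) (pauliRotation (Pi.single k (0, 1)) * U) := by
  rw [← tGate_eq_pauliRotation, ← one_mul (tGate k)]
  exact .step t U 1 k hU isClifford_one

theorem IsDoped.pauliRotation_mul_of_anticommute {t : ℕ} {P Q : PauliString ι}
    (hQ : ∀ {U : QOp ι}, IsDoped t U → IsDoped (t + 1) (pauliRotation Q * U))
    (h : sympForm P Q = 1) {U : QOp ι} (hU : IsDoped t U) :
    IsDoped (t + 1) (pauliRotation P * U) := by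
  rw [pauliRotation_eq_exchange h, mul_assoc, mul_assoc]
  exact (hQ (hU.clifford_mul (isClifford_pauliExchange h))).clifford_mul
    (isClifford_pauliExchange h)

/-- A one-qubit string `q` anticommutes with both `P` and `Z`, and two exchanges turn `P` into `q`
and `q` into `Z`. -/
theorem IsDoped.pauliRotation_mul {t : ℕ} {U : QOp ι} (hU : IsDoped t U) {P : PauliString ι}
    (hP : P ≠ 0) : IsDoped (t + 1) (pauliRotation P * U) := by
  obtain ⟨k, hk⟩ := Function.ne_iff.mp hP
  have hletter : ∀ p : ZMod 2 × ZMod 2, p ≠ 0 →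
      ∃ q, letterForm p q = 1 ∧ letterForm q (0, 1) = 1 := by decide
  obtain ⟨q, hPq, hqZ⟩ := hletter (P k) hk
  refine IsDoped.pauliRotation_mul_of_anticommute (Q := Pi.single k q) (fun hV => ?_)
    (by rw [sympForm_single, hPq]) hU
  exact IsDoped.pauliRotation_mul_of_anticommute (fun hW => hW.pauliRotation_single_Z_mul k)
    (by rw [sympForm_single, Pi.single_eq_same, hqZ]) hV

end Rotations

section RotatedSupport

theorem sum_single_add_smul {α V : Type*} [Fintype α] [DecidableEq α] [AddCommGroup V]
    [Module (ZMod 2) V] (v : α → V) (i : α) (A : α → ZMod 2) :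
    ∑ j, (Pi.single i 1 + A : α → ZMod 2) j • v j = v i + ∑ j, A j • v j := by
  simp only [Pi.add_apply, add_smul, Finset.sum_add_distrib, Pi.single_apply, ite_smul, one_smul,
    zero_smul, Finset.sum_ite_eq', Finset.mem_univ, if_true]

variable {ι κ : Type} [Fintype ι] [Fintype κ]

theorem sympForm_elim_zero (P : PauliString κ) (g : PauliString (ι ⊕ κ)) :
    sympForm (Sum.elim 0 P) g = sympForm (g ∘ Sum.inr) P := by
  rw [sympForm_comm]
  simp [sympForm_apply, Fintype.sum_sum_type, letterForm]

/-- The ancilla parts that some sum of strings `P i`, `i ∈ s`, anticommuting with them carries into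
`N`. Rotating by the commuting strings `P i` turns the support `N` into this one. -/
def RotatedSupport {α : Type*} [Fintype α] (P : α → PauliString κ) (N : PauliString κ → Prop)
    (s : Finset α) (e : PauliString κ) : Prop :=
  ∃ A : α → ZMod 2, (∀ i, A i = 1 → i ∈ s ∧ sympForm e (P i) = 1) ∧ N (e + ∑ i, A i • P i)

variable {α : Type*} [Fintype α] {P : α → PauliString κ} {N : PauliString κ → Prop} {s : Finset α}
  {e : PauliString κ}

theorem rotatedSupport_empty : RotatedSupport P N ∅ e ↔ N e := by
  refine ⟨?_, fun h => ⟨0, by simp, by simpa using h⟩⟩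
  rintro ⟨A, hA, hN⟩
  have hA0 : ∀ i, A i = 0 := fun i =>
    (zmod_two_cases (A i)).resolve_right fun h => by simpa using hA i h
  simpa [hA0] using hN

variable [DecidableEq α]

theorem rotatedSupport_insert (hP : ∀ i j, sympForm (P i) (P j) = 0) {i : α} (hi : i ∉ s) :
    RotatedSupport P N (insert i s) e ↔
      RotatedSupport P N s e ∨ sympForm e (P i) = 1 ∧ RotatedSupport P N s (e + P i) := by
  constructor
  · rintro ⟨A, hA, hN⟩
    rcases zmod_two_cases (A i) with h0 | h1
    · refine .inl ⟨A, fun j hj => ⟨?_, (hA j hj).2⟩, hN⟩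
      exact Finset.mem_of_mem_insert_of_ne (hA j hj).1 fun h => by simp [← h, hj] at h0
    · have hsum := sum_single_add_smul P i (Pi.single i 1 + A)
      rw [← add_assoc, ← Pi.single_add, CharTwo.add_self_eq_zero, Pi.single_zero, zero_add] at hsum
      refine .inr ⟨(hA i h1).2, Pi.single i 1 + A, fun j hj => ?_, ?_⟩
      · have hji : j ≠ i := fun h => by simp [h, h1, CharTwo.add_self_eq_zero] at hj
        have hAj : A j = 1 := by simpa [hji] using hj
        exact ⟨Finset.mem_of_mem_insert_of_ne (hA j hAj).1 hji, by simp [hP, (hA j hAj).2]⟩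
      · rwa [add_assoc, ← hsum]
  · rintro (⟨A, hA, hN⟩ | ⟨he, A, hA, hN⟩)
    · exact ⟨A, fun j hj => ⟨Finset.mem_insert_of_mem (hA j hj).1, (hA j hj).2⟩, hN⟩
    · refine ⟨Pi.single i 1 + A, fun j hj => ?_, by rwa [sum_single_add_smul, ← add_assoc]⟩
      rcases eq_or_ne j i with rfl | hji
      · exact ⟨Finset.mem_insert_self j s, he⟩
      · have hAj := hA j (by simpa [hji] using hj)
        exact ⟨Finset.mem_insert_of_mem hAj.1, by simpa [hP] using hAj.2⟩

omit [DecidableEq α] in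
theorem RotatedSupport.not_add (hP : ∀ i j, sympForm (P i) (P j) = 0)
    (hcancel : ∀ e (A : α → ZMod 2), (∀ i, A i = 1 → sympForm e (P i) = 1) →
      N e → N (e + ∑ i, A i • P i) → A = 0)
    {i : α} (hi : i ∉ s) (he : sympForm e (P i) = 1) (h : RotatedSupport P N s e) :
    ¬ RotatedSupport P N s (e + P i) := by
  classical
  rintro ⟨B, hB, hNB⟩
  obtain ⟨A, hA, hNA⟩ := h
  have h0 : ∀ C : α → ZMod 2, (∀ j, C j = 1 → j ∈ s) → C i = 0 := fun C hC =>
    (zmod_two_cases (C i)).resolve_right fun h => hi (hC i h)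
  have hsymp : ∀ g (C : α → ZMod 2) j, sympForm (g + ∑ i, C i • P i) (P j) = sympForm g (P j) := by
    simp [hP]
  have hAB := hcancel (e + ∑ j, A j • P j) (Pi.single i 1 + (A + B)) (fun j hj => ?_) hNA ?_
  · simpa [h0 A fun j hj => (hA j hj).1, h0 B fun j hj => (hB j hj).1] using congrFun hAB i
  · rw [hsymp]
    rcases eq_or_ne j i with rfl | hji
    · exact he
    · rcases zmod_two_cases (A j) with h | h
      · simpa [hP] using (hB j (by simpa [hji, h] using hj)).2
      · exact (hA j h).2
  · convert hNB using 1
    rw [sum_single_add_smul]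
    simp only [Pi.add_apply, add_smul, Finset.sum_add_distrib]
    calc e + ∑ j, A j • P j + (P i + (∑ j, A j • P j + ∑ j, B j • P j))
        = e + P i + ∑ j, B j • P j + (∑ j, A j • P j + ∑ j, A j • P j) := by abel
      _ = e + P i + ∑ j, B j • P j := by rw [ZModModule.add_self, add_zero]

variable [DecidableEq ι] [DecidableEq κ]

theorem HasEffectiveSupport.pauliRotation_mul {U : QOp (ι ⊕ κ)} {ψ : QSpace κ}
    {N : PauliString κ → Prop} (hU : HasEffectiveSupport U ψ N) {P : PauliString κ}
    (hP : ∀ e, sympForm e P = 1 → N e → ¬ N (e + P)) :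
    HasEffectiveSupport (pauliRotation (Sum.elim (0 : PauliString ι) P) * U) ψ
      fun e => N e ∨ sympForm e P = 1 ∧ N (e + P) := by
  intro g
  rw [effectiveOp_mul]
  have hs := sympForm_elim_zero (ι := ι) P g
  rcases zmod_two_cases (sympForm (g ∘ Sum.inr) P) with h | h
  · rw [pauliRotation_conj_of_commute (hs.trans h)]
    simpa [h] using hU g
  · obtain ⟨d, hd, hmul⟩ := pauliOp_mul g (Sum.elim (0 : PauliString ι) P)
    obtain ⟨c, hc, hcN⟩ := hU g
    obtain ⟨c', hc', hcN'⟩ := hU (g + Sum.elim (0 : PauliString ι) P)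
    rw [show (g + Sum.elim (0 : PauliString ι) P) ∘ Sum.inl = g ∘ Sum.inl by ext1; simp] at hc'
    rw [show (g + Sum.elim (0 : PauliString ι) P) ∘ Sum.inr = g ∘ Sum.inr + P by
      ext1; simp] at hcN'
    have hd0 : d ≠ 0 := by rintro rfl; norm_num at hd
    have ha : (tPhase + star tPhase) / 2 ≠ 0 := div_ne_zero tPhase_add_star_ne_zero two_ne_zero
    have hb : (star tPhase - tPhase) / 2 ≠ 0 := div_ne_zero star_sub_tPhase_ne_zero two_ne_zero
    refine ⟨(tPhase + star tPhase) / 2 * c + (star tPhase - tPhase) / 2 * d * c', ?_, ?_⟩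
    · rw [pauliRotation_conj_of_anticommute (hs.trans h), hmul]
      simp only [map_add, map_smul, hc, hc', smul_smul, add_smul, mul_assoc]
    · have hcc' : c ≠ 0 → c' = 0 := fun h0 =>
        not_not.mp fun h1 => hP _ h (hcN.mp h0) (hcN'.mp h1)
      change _ ↔ N (g ∘ Sum.inr) ∨ _ ∧ N (g ∘ Sum.inr + P)
      rw [← hcN, ← hcN', h, eq_self, true_and]
      by_cases h0 : c = 0
      · simp only [h0, mul_zero, zero_add, ne_eq, mul_eq_zero, hb, hd0, not_true_eq_false, false_or]
      · simp only [hcc' h0, mul_zero, add_zero, ne_eq, mul_eq_zero, ha, h0, or_false,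
          not_false_eq_true, not_true_eq_false]

omit [DecidableEq α] in
/-- At most one sum of the strings contributes by `hcancel`, so no contributions cancel. -/
theorem exists_isDoped_hasEffectiveSupport_of_commuting
    (hP : ∀ i j, sympForm (P i) (P j) = 0) {t : ℕ} {U : QOp (ι ⊕ κ)} {ψ : QSpace κ}
    (hU : IsDoped t U) (hN : HasEffectiveSupport U ψ N)
    (hcancel : ∀ e (A : α → ZMod 2), (∀ i, A i = 1 → sympForm e (P i) = 1) →
      N e → N (e + ∑ i, A i • P i) → A = 0)
    (hs : ∀ i ∈ s, P i ≠ 0) :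
    ∃ V : QOp (ι ⊕ κ), IsDoped (t + s.card) V ∧ HasEffectiveSupport V ψ (RotatedSupport P N s) := by
  classical
  induction s using Finset.induction_on with
  | empty => exact ⟨U, hU, hN.congr fun e => rotatedSupport_empty.symm⟩
  | insert i s hi ih =>
    obtain ⟨V, hV, hVs⟩ := ih fun j hj => hs j (Finset.mem_insert_of_mem hj)
    have hPi : Sum.elim (0 : PauliString ι) (P i) ≠ 0 := fun h =>
      hs i (Finset.mem_insert_self i s) (congrArg (· ∘ Sum.inr) h)
    rw [Finset.card_insert_of_notMem hi]
    exact ⟨_, hV.pauliRotation_mul hPi, (hVs.pauliRotation_mul fun e he hes =>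
      hes.not_add hP hcancel hi he).congr fun e => (rotatedSupport_insert hP hi).symm⟩

end RotatedSupport

section ExtendedStrings

variable {ι κ : Type}

/-- The Pauli string that carries the letters of `x` to the positions `f j` and is trivial
elsewhere. -/
noncomputable def extendString (f : ι ↪ κ) : PauliString ι →ₗ[ZMod 2] PauliString κ where
  toFun x := Function.extend f x (0 : PauliString κ)
  map_add' x y := by
    rw [← Function.extend_add, add_zero]
  map_smul' c x := by
    rw [RingHom.id_apply, ← Function.extend_smul, smul_zero]

theorem extendString_apply (f : ι ↪ κ) (x : PauliString ι) (j : ι) :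
    extendString f x (f j) = x j :=
  f.injective.extend_apply x (0 : PauliString κ) j

theorem extendString_apply_of_notMem (f : ι ↪ κ) (x : PauliString ι) {k : κ}
    (hk : k ∉ Set.range f) : extendString f x k = 0 :=
  Function.extend_apply' x (0 : PauliString κ) k hk

theorem extendString_ne_zero (f : ι ↪ κ) {x : PauliString ι} (hx : x ≠ 0) :
    extendString f x ≠ 0 := fun h =>
  hx (funext fun j => by rw [← extendString_apply f x j, h]; rfl)

variable [Fintype ι] [Fintype κ]

theorem sympForm_extendString_right (f : ι ↪ κ) (e : PauliString κ) (x : PauliString ι) :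
    sympForm e (extendString f x) = sympForm (e ∘ f) x := by
  refine (Fintype.sum_of_injective f f.injective _ _ (fun k hk => ?_) fun j => ?_).symm
  · rw [extendString_apply_of_notMem f x hk]
    simp [letterForm]
  · rw [extendString_apply, Function.comp_apply]

theorem sympForm_extendString (f : ι ↪ κ) (x y : PauliString ι) :
    sympForm (extendString f x) (extendString f y) = sympForm x y := by
  rw [sympForm_extendString_right]
  exact congrArg (sympForm · y) (funext (extendString_apply f x))

end ExtendedStrings

section BlockCircuit

variable {ι κ : Type} {lam : Type*} [DecidableEq lam]

/-- The string with the letter `X` on the block `i` of the partition of `ι` into the fibers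
of `β`. -/
def blockXString (β : ι → lam) (i : lam) : PauliString ι := fun j => if β j = i then (1, 0) else 0

theorem sum_smul_blockXString [Fintype lam] (β : ι → lam) (A : lam → ZMod 2) :
    ∑ i, A i • blockXString β i = fun j => (A (β j), 0) := by
  funext j
  rw [Finset.sum_apply, Finset.sum_eq_single (β j)]
  · simp [blockXString]
  · intro i _ hi
    simp [blockXString, hi.symm]
  · simp

variable [Fintype ι]

/-- The strings on the data qubits in the span of the constructed POVM: after multiplication by `X`
on some blocks, in which the number of letters `Y` and `Z` is odd, they have no letter `Z`. -/
def IsBlockVisible (β : ι → lam) (p : PauliString ι) : Prop :=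
  ∃ A : lam → ZMod 2, (∀ i, A i = 1 → sympForm p (blockXString β i) = 1) ∧
    ∀ j, p j + (A (β j), 0) ≠ (0, 1)

theorem sympForm_blockXString (β : ι → lam) (p : PauliString ι) (i : lam) :
    sympForm p (blockXString β i) = ∑ j, if β j = i then (p j).2 else 0 := by
  refine Finset.sum_congr rfl fun j _ => ?_
  by_cases h : β j = i <;> simp [blockXString, letterForm, h]

theorem sympForm_blockXString_blockXString (β : ι → lam) (i i' : lam) :
    sympForm (blockXString β i) (blockXString β i') = 0 := by
  rw [sympForm_blockXString]
  exact Finset.sum_eq_zero fun k _ => by simp only [blockXString]; split_ifs <;> rfl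

theorem eq_zero_of_forall_add_ne_Z {β : ι → lam} {p : PauliString ι} {A : lam → ZMod 2}
    (hA : ∀ i, A i = 1 → sympForm p (blockXString β i) = 1) (hp : ∀ j, p j ≠ (0, 1))
    (hpA : ∀ j, p j + (A (β j), 0) ≠ (0, 1)) : A = 0 := by
  refine funext fun i => (zmod_two_cases (A i)).resolve_right fun hi => ?_
  obtain ⟨j, -, hj⟩ := Finset.exists_ne_zero_of_sum_ne_zero
    (((sympForm_blockXString β p i).symm.trans (hA i hi)).trans_ne one_ne_zero)
  obtain ⟨rfl, hj2⟩ := ite_ne_right_iff.mp hj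
  have hY : ∀ q : ZMod 2 × ZMod 2, q ≠ (0, 1) → q.2 ≠ 0 → q + (1, 0) = (0, 1) := by decide
  exact hpA j (by rw [hi, hY _ (hp j) hj2])

variable [DecidableEq ι] [Fintype κ] [DecidableEq κ]

theorem exists_isDoped_hasEffectiveSupport_plus [Nonempty κ] (t : ℕ) :
    ∃ U : QOp (ι ⊕ κ), IsDoped t U ∧
      HasEffectiveSupport U (productState κ plusAmplitude) fun e => ∀ k, (e k).2 = 0 := by
  induction t with
  | zero => exact ⟨1, .clifford 1 isClifford_one, hasEffectiveSupport_one_plus⟩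
  | succ t ih =>
    obtain ⟨U, hU, hN⟩ := ih
    obtain ⟨k⟩ := ‹Nonempty κ›
    have hX : ∀ e : PauliString κ, sympForm e (Pi.single k (1, 0)) = (e k).2 := fun e => by
      simp [sympForm_single, letterForm]
    have hne : Sum.elim (0 : PauliString ι) (Pi.single k (1, 0)) ≠ 0 := fun h => by
      simpa using congrFun h (Sum.inr k)
    refine ⟨_, hU.pauliRotation_mul hne, (hN.pauliRotation_mul fun e he he0 => ?_).congr
      fun e => or_iff_left ?_⟩
    · simp [hX, he0 k] at he
    · rintro ⟨he, he0⟩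
      simpa [← hX, he] using he0 k

theorem exists_isDoped_hasEffectiveSupport_magic [Nonempty κ] (f : ι ↪ κ) (t : ℕ) :
    ∃ U : QOp (ι ⊕ κ), IsDoped (t + Fintype.card ι) U ∧
      HasEffectiveSupport U (productState κ plusAmplitude) fun e =>
        (∀ j, e (f j) ≠ (0, 1)) ∧ ∀ k ∉ Set.range f, (e k).2 = 0 := by
  obtain ⟨U, hU, hN⟩ := exists_isDoped_hasEffectiveSupport_plus (ι := ι) (κ := κ) t
  let P : ι → PauliString κ := fun j => extendString f (Pi.single j (0, 1))
  have hsum : ∀ A : ι → ZMod 2, ∑ j, A j • P j = extendString f fun j => (0, A j) := fun A => by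
    simp only [P, ← map_smul, ← map_sum]
    congr 1
    funext j
    simp [Finset.sum_apply, Pi.single_apply]
  have hP : ∀ e j, sympForm e (P j) = (e (f j)).1 := fun e j => by
    simp [P, sympForm_extendString_right, sympForm_single, letterForm]
  have hcomm : ∀ i j, sympForm (P i) (P j) = 0 := fun i j => by
    rw [sympForm_extendString, sympForm_single]
    rcases eq_or_ne j i with rfl | hij <;> simp [letterForm, *]
  obtain ⟨V, hV, hVN⟩ := exists_isDoped_hasEffectiveSupport_of_commuting hcomm hU hN
    (fun e A _ he heA => funext fun j => by
      simpa [hsum, he, extendString_apply] using heA (f j))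
    fun j (_ : j ∈ Finset.univ) => extendString_ne_zero f (by simp)
  refine ⟨V, hV, hVN.congr fun e => ?_⟩
  simp only [RotatedSupport, hsum, hP, Finset.mem_univ, true_and]
  constructor
  · rintro ⟨A, hA, hN⟩
    refine ⟨fun j hj => ?_, fun k hk => ?_⟩
    · have h1 : 1 + A j = 0 := by simpa [extendString_apply, hj] using hN (f j)
      simpa [hj] using hA j (CharTwo.add_eq_zero.mp h1).symm
    · simpa [extendString_apply_of_notMem f _ hk] using hN k
  · rintro ⟨he, he0⟩
    refine ⟨fun j => (e (f j)).2, fun j hj => ?_, fun k => ?_⟩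
    · exact (zmod_two_cases _).resolve_left fun h => he j (Prod.ext h hj)
    · by_cases hk : k ∈ Set.range f
      · obtain ⟨j, rfl⟩ := hk
        simp [extendString_apply, CharTwo.add_self_eq_zero]
      · simp [extendString_apply_of_notMem f _ hk, he0 k hk]

theorem exists_isDoped_hasEffectiveSupport_isBlockVisible [Nonempty κ] [Fintype lam] (f : ι ↪ κ)
    (β : ι → lam) :
    ∃ U : QOp (ι ⊕ κ), IsDoped (Fintype.card ι + Fintype.card lam) U ∧
      HasEffectiveSupport U (productState κ plusAmplitude) fun e =>
        IsBlockVisible β (e ∘ f) ∧ ∀ k ∉ Set.range f, (e k).2 = 0 := by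
  let s : Finset lam := Finset.univ.filter fun i => blockXString β i ≠ 0
  obtain ⟨U, hU, hN⟩ := exists_isDoped_hasEffectiveSupport_magic f (Fintype.card lam - s.card)
  have hsum : ∀ A : lam → ZMod 2, ∑ i, A i • extendString f (blockXString β i) =
      extendString f fun j => (A (β j), 0) := fun A => by
    simp only [← map_smul, ← map_sum, sum_smul_blockXString]
  obtain ⟨V, hV, hVN⟩ := exists_isDoped_hasEffectiveSupport_of_commuting
    (fun i i' => by rw [sympForm_extendString, sympForm_blockXString_blockXString]) hU hN
    (fun e A hA he heA => by
      simp only [hsum, Pi.add_apply, extendString_apply] at heA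
      simp only [sympForm_extendString_right] at hA
      exact eq_zero_of_forall_add_ne_Z hA he.1 heA.1)
    (s := s) fun i hi => extendString_ne_zero f (Finset.mem_filter.mp hi).2
  refine ⟨V, ?_, hVN.congr fun e => ?_⟩
  · convert hV using 1
    have := s.card_le_univ
    omega
  · have hmem : ∀ i, sympForm (e ∘ f) (blockXString β i) = 1 → i ∈ s := fun i hi => by
      refine Finset.mem_filter.mpr ⟨Finset.mem_univ i, fun h0 => ?_⟩
      simp [h0] at hi
    have hA : ∀ i, i ∈ s ∧ sympForm (e ∘ f) (blockXString β i) = 1 ↔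
        sympForm (e ∘ f) (blockXString β i) = 1 := fun i => and_iff_right_of_imp (hmem i)
    have hout : ∀ A : lam → ZMod 2, (∀ k ∉ Set.range f,
        ((e + extendString f fun j => (A (β j), 0)) k).2 = 0) ↔ ∀ k ∉ Set.range f, (e k).2 = 0 :=
      fun A => forall₂_congr fun k hk => by simp [extendString_apply_of_notMem f _ hk]
    simp only [RotatedSupport, IsBlockVisible, sympForm_extendString_right, hA, hsum, hout]
    simp only [Pi.add_apply, extendString_apply, Function.comp_apply]
    tauto

end BlockCircuit

section BellGroup

variable {ι κ : Type}

/-- The stabilizer group of the measurement of each qubit `j` of `ι` together with the qubit `f j`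
of `κ` in the Bell basis and of `X` on the other qubits of `κ`. -/
def bellGroup (f : ι ↪ κ) : AddSubgroup (PauliString (ι ⊕ κ)) where
  carrier := {g | (∀ j, g (Sum.inr (f j)) = g (Sum.inl j)) ∧
    ∀ k ∉ Set.range f, (g (Sum.inr k)).2 = 0}
  add_mem' hg hh := ⟨fun j => by simp [hg.1 j, hh.1 j],
    fun k hk => by simp [hg.2 k hk, hh.2 k hk]⟩
  zero_mem' := ⟨fun _ => rfl, fun _ _ => rfl⟩
  neg_mem' hg := ⟨fun j => by simp [hg.1 j], fun k hk => by simp [hg.2 k hk]⟩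

theorem exists_mem_bellGroup_iff {f : ι ↪ κ} {N : PauliString ι → Prop} {p : PauliString ι} :
    (∃ g ∈ bellGroup f, g ∘ Sum.inl = p ∧
      N ((g ∘ Sum.inr) ∘ f) ∧ ∀ k ∉ Set.range f, ((g ∘ Sum.inr) k).2 = 0) ↔ N p := by
  constructor
  · rintro ⟨g, hg, rfl, hN, -⟩
    rwa [show (g ∘ Sum.inr) ∘ f = g ∘ Sum.inl from funext hg.1] at hN
  · intro hN
    have hout : ∀ k ∉ Set.range f, (extendString f p k).2 = 0 := fun k hk => by
      rw [extendString_apply_of_notMem f p hk]; rfl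
    refine ⟨Sum.elim p (extendString f p), ⟨extendString_apply f p, hout⟩, rfl, ?_, hout⟩
    rwa [Sum.elim_comp_inr, show extendString f p ∘ f = p from funext (extendString_apply f p)]

theorem eq_of_letterForm_add_eq_zero {p q : ZMod 2 × ZMod 2}
    (h : ∀ x, letterForm p x + letterForm q x = 0) : q = p := by
  revert p q; decide

variable [Fintype ι] [Fintype κ] [DecidableEq ι] [DecidableEq κ]

theorem isStabilizerGroup_bellGroup (f : ι ↪ κ) : IsStabilizerGroup (bellGroup f) := by
  refine (isStabilizerGroup_iff _).mpr fun g => ⟨fun hg h hh => ?_, fun hg => ⟨fun j => ?_, ?_⟩⟩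
  · have hcopy : ∑ j, letterForm (g (Sum.inl j)) (h (Sum.inl j)) =
        ∑ k, letterForm (g (Sum.inr k)) (h (Sum.inr k)) := by
      refine Fintype.sum_of_injective f f.injective _ _ (fun k hk => ?_) fun j => ?_
      · simp [letterForm, hg.2 k hk, hh.2 k hk]
      · rw [hg.1, hh.1]
    rw [sympForm_apply, Fintype.sum_sum_type, hcopy, CharTwo.add_self_eq_zero]
  · refine eq_of_letterForm_add_eq_zero fun x => ?_
    have hx := hg (Pi.single (Sum.inl j) x + Pi.single (Sum.inr (f j)) x)
      ⟨fun i => by simp [Pi.single_apply], fun k hk => ?_⟩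
    · simpa [sympForm_single] using hx
    · have hkj : k ≠ f j := fun h => hk ⟨j, h.symm⟩
      simp [hkj]
  · intro k hk
    have hx := hg (Pi.single (Sum.inr k) (1, 0)) ⟨fun i => ?_, fun k' _ => ?_⟩
    · simpa [sympForm_single, letterForm] using hx
    · have hki : f i ≠ k := fun h => hk ⟨i, h⟩
      simp [hki]
    · rcases eq_or_ne k' k with rfl | h <;> simp [*]

end BellGroup

section CodeGroup

variable {ι κ : Type} {lam : Type*}

theorem register_ext (e : ι ⊕ lam ≃ κ) {g h : PauliString (ι ⊕ κ)}
    (hdata : ∀ j, g (Sum.inl j) = h (Sum.inl j))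
    (hcopy : ∀ j, g (Sum.inr (e (Sum.inl j))) = h (Sum.inr (e (Sum.inl j))))
    (hhead : ∀ i, g (Sum.inr (e (Sum.inr i))) = h (Sum.inr (e (Sum.inr i)))) : g = h := by
  funext k
  rcases k with j | k
  · exact hdata j
  · obtain ⟨j | i, rfl⟩ := e.surjective k
    · exact hcopy j
    · exact hhead i

theorem extendString_inr (q : PauliString κ) :
    extendString Function.Embedding.inr q = Sum.elim (0 : PauliString ι) q := by
  funext k
  rcases k with j | k
  · exact extendString_apply_of_notMem _ q (by simp)
  · exact extendString_apply Function.Embedding.inr q k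

variable [Fintype ι] [DecidableEq lam] (e : ι ⊕ lam ≃ κ) (β : ι → lam)

theorem sympForm_add_blockXString (p : PauliString ι) (A : lam → ZMod 2) (i : lam) :
    sympForm (fun j => p j + (A (β j), 0)) (blockXString β i) = sympForm p (blockXString β i) := by
  simp only [sympForm_blockXString, Prod.snd_add, add_zero]

theorem sum_mul_sympForm_blockXString [Fintype lam] (p : PauliString ι) (A : lam → ZMod 2) :
    ∑ i, A i * sympForm p (blockXString β i) = sympForm p fun j => (A (β j), 0) := by
  simp only [← sum_smul_blockXString, map_sum, map_smul, smul_eq_mul]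

/-- The string with data part `x.1` and with the phase-flip pattern `x.2` on the heads in the
stabilizer group of the magic state form of the construction. The register `κ` consists of a copy
`e (inl j)` of each data qubit `j` and a head `e (inr i)` of each block `i`. -/
def codeString : PauliString ι × (lam → ZMod 2) →+ PauliString (ι ⊕ κ) :=
  AddMonoidHom.mk' (fun x => Sum.elim x.1 (Sum.elim (fun j => x.1 j + (x.2 (β j), 0))
    (fun i => (sympForm x.1 (blockXString β i), x.2 i)) ∘ e.symm)) fun x y => by
      funext k
      rcases k with j | k
      · rfl
      · obtain ⟨j | i, rfl⟩ := e.surjective k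
        · simp [add_add_add_comm]
        · simp

/-- The stabilizer group of the magic state form of the construction. -/
def codeGroup : AddSubgroup (PauliString (ι ⊕ κ)) := (codeString e β).range

variable (x : PauliString ι × (lam → ZMod 2))

theorem codeString_inl (j : ι) : codeString e β x (Sum.inl j) = x.1 j := rfl

theorem codeString_copy (j : ι) :
    codeString e β x (Sum.inr (e (Sum.inl j))) = x.1 j + (x.2 (β j), 0) := by
  simp [codeString]

theorem codeString_head (i : lam) :
    codeString e β x (Sum.inr (e (Sum.inr i))) = (sympForm x.1 (blockXString β i), x.2 i) := by
  simp [codeString]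

theorem exists_mem_codeGroup_iff {p : PauliString ι} :
    (∃ g ∈ codeGroup e β, g ∘ Sum.inl = p ∧ ∀ k, (g ∘ Sum.inr) k ≠ (0, 1)) ↔
      IsBlockVisible β p := by
  have hhead : ∀ x y : ZMod 2, ((x, y) : ZMod 2 × ZMod 2) ≠ (0, 1) ↔ (y = 1 → x = 1) := by decide
  have hvisible : ∀ x, (∀ k, codeString e β x (Sum.inr k) ≠ (0, 1)) ↔
      (∀ j, x.1 j + (x.2 (β j), 0) ≠ (0, 1)) ∧
        ∀ i, x.2 i = 1 → sympForm x.1 (blockXString β i) = 1 := fun x => by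
    rw [← e.forall_congr_right, Sum.forall]
    simp only [codeString_copy, codeString_head, hhead]
  constructor
  · rintro ⟨_, ⟨x, rfl⟩, rfl, h⟩
    exact ⟨x.2, ((hvisible x).mp h).symm⟩
  · rintro ⟨A, hA⟩
    exact ⟨_, ⟨(p, A), rfl⟩, rfl, (hvisible (p, A)).mpr hA.symm⟩

theorem eq_zero_of_elim_zero_mem_codeGroup {p : PauliString ι}
    (h : Sum.elim p (0 : PauliString κ) ∈ codeGroup e β) : p = 0 := by
  obtain ⟨x, hx⟩ := h
  have hA : ∀ i, x.2 i = 0 := fun i => by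
    have hi := congrFun hx (Sum.inr (e (Sum.inr i)))
    rw [codeString_head] at hi
    exact congrArg Prod.snd hi
  funext j
  have hp : x.1 j = p j := congrFun hx (Sum.inl j)
  have hj := congrFun hx (Sum.inr (e (Sum.inl j)))
  rw [codeString_copy, hA, hp] at hj
  exact (add_zero (p j)).symm.trans hj

theorem elim_zero_mem_codeGroup_iff [Finite lam] {G : lam → PauliString κ}
    (hG : ∀ i, Sum.elim (0 : PauliString ι) (G i) = codeString e β (0, Pi.single i 1))
    {q : PauliString κ} :
    Sum.elim (0 : PauliString ι) q ∈ codeGroup e β ↔ q ∈ AddSubgroup.closure (Set.range G) := by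
  cases nonempty_fintype lam
  have hG' : ∀ i, extendString Function.Embedding.inr (G i) =
      codeString e β (0, Pi.single i 1) := fun i => (extendString_inr (G i)).trans (hG i)
  constructor
  · rintro ⟨⟨p, A⟩, h⟩
    obtain rfl : p = 0 := funext fun j => congrFun h (Sum.inl j)
    have hq : q = ∑ i, A i • G i := by
      funext k
      have hk := congrFun h (Sum.inr k)
      have hGk : ∀ i, G i k = codeString e β (0, Pi.single i 1) (Sum.inr k) := fun i =>
        congrFun (hG i) (Sum.inr k)
      rw [Finset.sum_apply, ← show _ = q k from hk]
      simp only [Pi.smul_apply, hGk]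
      obtain ⟨j | i, rfl⟩ := e.surjective k
      · simp only [codeString_copy]
        ext <;> simp [Prod.fst_sum, Prod.snd_sum, Pi.single_apply]
      · simp only [codeString_head]
        ext <;> simp [Prod.fst_sum, Prod.snd_sum, Pi.single_apply]
    rw [hq]
    refine sum_mem fun i _ => ?_
    rcases zmod_two_cases (A i) with hi | hi
    · rw [hi, zero_smul]
      exact zero_mem _
    · rw [hi, one_smul]
      exact AddSubgroup.subset_closure ⟨i, rfl⟩
  · rw [← extendString_inr]
    suffices AddSubgroup.closure (Set.range G) ≤ (codeGroup e β).comap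
      (extendString (Function.Embedding.inr : κ ↪ ι ⊕ κ)).toAddMonoidHom from fun hq => this hq
    rw [AddSubgroup.closure_le]
    rintro _ ⟨i, rfl⟩
    exact ⟨(0, Pi.single i 1), (hG' i).symm⟩

variable [Fintype κ]

theorem sympForm_codeString [Fintype lam] (g : PauliString (ι ⊕ κ)) :
    sympForm g (codeString e β x) =
      sympForm (fun j => g (Sum.inl j) + g (Sum.inr (e (Sum.inl j))) +
        ((g (Sum.inr (e (Sum.inr (β j))))).2, 0)) x.1 +
      ∑ i, x.2 i * ((g (Sum.inr (e (Sum.inr i)))).1 +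
        sympForm (fun j => g (Sum.inr (e (Sum.inl j)))) (blockXString β i)) := by
  have hheads := (sum_mul_sympForm_blockXString β x.1 fun i =>
    (g (Sum.inr (e (Sum.inr i)))).2).trans (sympForm_comm _ _)
  have hcopies := sum_mul_sympForm_blockXString β (fun j => g (Sum.inr (e (Sum.inl j)))) x.2
  have hsum : sympForm g (codeString e β x) = sympForm (fun j => g (Sum.inl j)) x.1 +
      (sympForm (fun j => g (Sum.inr (e (Sum.inl j)))) (x.1 + fun j => (x.2 (β j), 0)) +
        ∑ i, letterForm (g (Sum.inr (e (Sum.inr i))))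
          (sympForm x.1 (blockXString β i), x.2 i)) := by
    rw [sympForm_apply, Fintype.sum_sum_type, ← e.sum_comp, Fintype.sum_sum_type]
    simp only [codeString_inl, codeString_copy, codeString_head]
    rfl
  have hsplit : (fun j => g (Sum.inl j) + g (Sum.inr (e (Sum.inl j))) +
      ((g (Sum.inr (e (Sum.inr (β j))))).2, 0)) = (fun j => g (Sum.inl j)) +
        (fun j => g (Sum.inr (e (Sum.inl j)))) +
          fun j => ((g (Sum.inr (e (Sum.inr (β j))))).2, 0) := rfl
  simp only [hsum, hsplit, letterForm, map_add, LinearMap.add_apply, mul_add,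
    Finset.sum_add_distrib, hheads, hcopies, mul_comm (Prod.fst _)]
  ring

theorem isStabilizerGroup_codeGroup [Finite lam] [DecidableEq ι] [DecidableEq κ] :
    IsStabilizerGroup (codeGroup e β) := by
  cases nonempty_fintype lam
  refine (isStabilizerGroup_iff _).mpr fun g => ⟨?_, fun hg => ?_⟩
  · rintro ⟨y, rfl⟩ _ ⟨x, rfl⟩
    have hcopy : ∀ j, y.1 j + (y.1 j + (y.2 (β j), 0)) + (y.2 (β j), 0) = 0 := fun j => by
      rw [← add_assoc, add_assoc, ZModModule.add_self, ZModModule.add_self, add_zero]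
    rw [sympForm_codeString]
    simp only [codeString_inl, codeString_copy, codeString_head, hcopy,
      sympForm_add_blockXString, CharTwo.add_self_eq_zero, mul_zero, Finset.sum_const_zero,
      add_zero]
    exact LinearMap.map_zero₂ sympForm x.1
  · have hform := fun x => (sympForm_codeString e β x g).symm.trans (hg _ ⟨x, rfl⟩)
    have hcopy : ∀ j, g (Sum.inl j) + g (Sum.inr (e (Sum.inl j))) +
        ((g (Sum.inr (e (Sum.inr (β j))))).2, 0) = 0 := fun j =>
      eq_of_letterForm_add_eq_zero fun z => by
        rw [show letterForm 0 z = 0 by simp [letterForm], zero_add]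
        simpa [sympForm_single] using hform (Pi.single j z, 0)
    have hhead : ∀ i, (g (Sum.inr (e (Sum.inr i)))).1 +
        sympForm (fun j => g (Sum.inr (e (Sum.inl j)))) (blockXString β i) = 0 := fun i => by
      simpa [Pi.single_apply] using hform (0, Pi.single i 1)
    have hcopy' : ∀ j, g (Sum.inr (e (Sum.inl j))) =
        g (Sum.inl j) + ((g (Sum.inr (e (Sum.inr (β j))))).2, 0) := fun j =>
      CharTwo.add_eq_zero.mp ((add_right_comm _ _ _).trans (hcopy j)) |>.symm
    have hhead' : ∀ i, (g (Sum.inr (e (Sum.inr i)))).1 =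
        sympForm (g ∘ Sum.inl) (blockXString β i) := fun i => by
      rw [CharTwo.add_eq_zero.mp (hhead i), funext hcopy']
      exact sympForm_add_blockXString β _ (fun i => (g (Sum.inr (e (Sum.inr i)))).2) i
    refine ⟨(g ∘ Sum.inl, fun i => (g (Sum.inr (e (Sum.inr i)))).2),
      register_ext e (fun _ => rfl) (fun j => ?_) fun i => ?_⟩
    · exact (codeString_copy ..).trans (hcopy' j).symm
    · rw [codeString_head, ← hhead']

end CodeGroup

section Counting

variable {ι : Type}

theorem finrank_span_pauliOp [Fintype ι] (P : PauliString ι → Prop) :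
    Module.finrank ℂ (Submodule.span ℂ (pauliOp '' {p | P p})) = Nat.card {p // P p} := by
  classical
  have h : LinearIndependent ℂ fun p : {p // P p} => pauliOp p.1 :=
    linearIndependent_pauliOp.comp _ Subtype.val_injective
  rw [Set.image_eq_range, Nat.card_eq_fintype_card]
  exact finrank_span_eq_card h

theorem sympForm_blockXString_eq_sum_fiber {lam : Type*} [DecidableEq lam] [Fintype ι]
    (β : ι → lam) (p : PauliString ι) (i : lam) :
    sympForm p (blockXString β i) = ∑ j : {j // β j = i}, (p j).2 := by
  rw [sympForm_blockXString, ← Finset.sum_filter]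
  exact Finset.sum_subtype _ (by simp) fun j => (p j).2

theorem isBlockVisible_iff_forall_fiber {lam : Type*} [DecidableEq lam] [Fintype ι]
    {β : ι → lam} {p : PauliString ι} :
    IsBlockVisible β p ↔
      ∀ i, IsBlockVisible (fun _ : {j // β j = i} => ()) fun j => p j := by
  have hparity : ∀ i, sympForm (fun j : {j // β j = i} => p j) (blockXString (fun _ => ()) ()) =
      sympForm p (blockXString β i) := fun i => by
    rw [sympForm_blockXString_eq_sum_fiber β, sympForm_blockXString]
    exact Finset.sum_congr rfl fun _ _ => if_pos rfl
  constructor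
  · rintro ⟨A, hA, hp⟩ i
    refine ⟨fun _ => A i, fun _ => (hparity i).trans ∘ hA i, ?_⟩
    rintro ⟨j, rfl⟩
    exact hp j
  · intro h
    choose A hA hp using h
    exact ⟨fun i => A i (), fun i hi => (hparity i).symm.trans (hA i () hi),
      fun j => hp _ ⟨j, rfl⟩⟩

theorem card_isBlockVisible {lam : Type} [Fintype lam] [DecidableEq lam] [Fintype ι]
    (β : ι → lam) :
    Nat.card {p : PauliString ι // IsBlockVisible β p} =
      ∏ i, Nat.card {p : PauliString {j // β j = i} // IsBlockVisible (fun _ => ()) p} := by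
  let restrict : PauliString ι ≃ ∀ i, PauliString {j // β j = i} :=
    ((Equiv.sigmaFiberEquiv β).arrowCongr (Equiv.refl _)).symm.trans
      (Equiv.piCurry fun _ _ => ZMod 2 × ZMod 2)
  rw [← Nat.card_pi]
  exact Nat.card_congr ((restrict.subtypeEquiv fun p => isBlockVisible_iff_forall_fiber).trans
    Equiv.subtypePiEquivPi)

theorem isBlockVisible_unit_iff [Fintype ι] {p : PauliString ι} :
    IsBlockVisible (fun _ => ()) p ↔
      (∀ j, p j ≠ (0, 1)) ∨ (∀ j, p j ≠ (1, 1)) ∧ ∑ j, (p j).2 = 1 := by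
  have hY : ∀ q : ZMod 2 × ZMod 2, q + (1, 0) ≠ (0, 1) ↔ q ≠ (1, 1) := by decide
  constructor
  · rintro ⟨A, hA, hp⟩
    rcases zmod_two_cases (A ()) with h | h
    · simp only [h] at hp
      exact Or.inl fun j => by simpa [Prod.mk_zero_zero] using hp j
    · refine Or.inr ⟨fun j => (hY _).mp (h ▸ hp j), ?_⟩
      simpa [sympForm_blockXString] using hA () h
  · rintro (h | ⟨h, hodd⟩)
    · exact ⟨0, fun _ h0 => absurd h0 zero_ne_one, fun j => by simpa [Prod.mk_zero_zero] using h j⟩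
    · exact ⟨1, fun _ _ => by simpa [sympForm_blockXString] using hodd, fun j => (hY _).mpr (h j)⟩

/-- The strings in which the letter `q` does not occur. -/
def stringsWithout (ι : Type) [Fintype ι] [DecidableEq ι] (q : ZMod 2 × ZMod 2) :
    Finset (PauliString ι) :=
  Fintype.piFinset fun _ => Finset.univ.erase q

theorem mem_stringsWithout [Fintype ι] [DecidableEq ι] {q : ZMod 2 × ZMod 2} {p : PauliString ι} :
    p ∈ stringsWithout ι q ↔ ∀ j, p j ≠ q := by
  simp [stringsWithout]

theorem card_stringsWithout [Fintype ι] [DecidableEq ι] (q : ZMod 2 × ZMod 2) :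
    (stringsWithout ι q).card = 3 ^ Fintype.card ι := by
  simp [stringsWithout, Fintype.card_piFinset]

theorem two_mul_card_filter_stringsWithout_Y [Fintype ι] [DecidableEq ι] :
    2 * (((stringsWithout ι (1, 1)).filter fun p => ∑ j, (p j).2 = 1).card : ℂ) =
      3 ^ Fintype.card ι - 1 := by
  have hsign : ∀ p : PauliString ι, (2 : ℂ) * (if ∑ j, (p j).2 = 1 then 1 else 0) =
      1 - ∏ j, pauliSign (p j).2 := fun p => by
    rw [← pauliSign_sum]
    rcases zmod_two_cases (∑ j, (p j).2) with h | h
    · simp [h]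
    · rw [h, if_pos rfl, pauliSign_one]; norm_num
  have hletters : ∑ q ∈ Finset.univ.erase (1, 1), pauliSign (q : ZMod 2 × ZMod 2).2 = 1 := by
    rw [show (Finset.univ.erase (1, 1) : Finset (ZMod 2 × ZMod 2)) = {(0, 0), (1, 0), (0, 1)} by
      decide]
    simp
  have hsum : ∑ p ∈ stringsWithout ι (1, 1), ∏ j, pauliSign (p j).2 = 1 :=
    (Finset.sum_prod_piFinset _ fun _ q => pauliSign (Prod.snd q)).trans (by simp [hletters])
  rw [← Finset.sum_boole, Finset.mul_sum, Finset.sum_congr rfl fun p _ => hsign p,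
    Finset.sum_sub_distrib, hsum, Finset.sum_const, card_stringsWithout]
  simp

theorem two_mul_card_isBlockVisible_unit (ι : Type) [Fintype ι] :
    2 * (Nat.card {p : PauliString ι // IsBlockVisible (fun _ => ()) p} : ℝ) =
      3 ^ (Fintype.card ι + 1) - 1 := by
  classical
  have hunion : (Finset.univ.filter fun p : PauliString ι => IsBlockVisible (fun _ => ()) p) =
      stringsWithout ι (0, 1) ∪ (stringsWithout ι (1, 1)).filter fun p => ∑ j, (p j).2 = 1 := by
    ext p
    simp [isBlockVisible_unit_iff, mem_stringsWithout]
  have hdisj : Disjoint (stringsWithout ι (0, 1))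
      ((stringsWithout ι (1, 1)).filter fun p => ∑ j, (p j).2 = 1) := by
    refine Finset.disjoint_left.mpr fun p hZ hp => ?_
    obtain ⟨hY, hodd⟩ := Finset.mem_filter.mp hp
    have hIX : ∀ q : ZMod 2 × ZMod 2, q ≠ (0, 1) → q ≠ (1, 1) → q.2 = 0 := by decide
    exact zero_ne_one (hodd ▸ (Finset.sum_eq_zero fun j _ =>
      hIX _ (mem_stringsWithout.mp hZ j) (mem_stringsWithout.mp hY j)).symm)
  have hodd : (2 : ℝ) * ((stringsWithout ι (1, 1)).filter fun p => ∑ j, (p j).2 = 1).card =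
      3 ^ Fintype.card ι - 1 := by
    exact_mod_cast two_mul_card_filter_stringsWithout_Y (ι := ι)
  rw [Nat.card_eq_fintype_card, Fintype.card_subtype, hunion, Finset.card_union_of_disjoint hdisj,
    card_stringsWithout, Nat.cast_add, mul_add, hodd]
  push_cast
  ring

end Counting

section Blocks

variable {n ℓ : ℕ} (β : Fin n → Fin ℓ)

/-- The partition of `n + ℓ` qubits into `ℓ` blocks: block `i` consists of the qubits `j` with
`β j = i` among the first `n` and of the qubit `n + i`, which is its last. -/
def headedBlock (i : Fin ℓ) : Finset (Fin (n + ℓ)) :=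
  Finset.univ.filter fun k => Fin.append β id k = i

theorem disjoint_headedBlock {i i' : Fin ℓ} (h : i ≠ i') :
    Disjoint (headedBlock β i) (headedBlock β i') :=
  Finset.disjoint_filter.mpr fun _ _ hi hi' => h (hi.symm.trans hi')

theorem card_headedBlock (i : Fin ℓ) :
    (headedBlock β i).card = Fintype.card {j // β j = i} + 1 := by
  rw [headedBlock, Finset.card_filter, Fin.sum_univ_add, Fintype.card_subtype, Finset.card_filter]
  simp

theorem xxzString_headedBlock_castAdd (i : Fin ℓ) (j : Fin n) :
    xxzString (headedBlock β i) (Fin.castAdd ℓ j) = if β j = i then (1, 0) else 0 := by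
  have hnotLast : ¬∀ k ∈ headedBlock β i, k ≤ Fin.castAdd ℓ j := fun h => by
    have hi := Fin.le_def.mp (h (Fin.natAdd n i) (by simp [headedBlock]))
    simp only [Fin.val_natAdd, Fin.val_castAdd] at hi
    omega
  rw [xxzString, if_neg hnotLast]
  simp [headedBlock, Prod.mk_zero_zero]

theorem xxzString_headedBlock_natAdd (i i' : Fin ℓ) :
    xxzString (headedBlock β i) (Fin.natAdd n i') = if i' = i then (0, 1) else 0 := by
  have hlast : i' = i → ∀ k ∈ headedBlock β i, k ≤ Fin.natAdd n i' := fun h k hk => by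
    induction k using Fin.addCases with
    | left j => exact Fin.le_def.mpr (by simp only [Fin.val_castAdd, Fin.val_natAdd]; omega)
    | right l =>
      have hl : l = i := by simpa [headedBlock] using hk
      rw [hl, h]
  by_cases h : i' = i
  · rw [xxzString, if_pos (hlast h)]
    simp [headedBlock, h]
  · simp [xxzString, headedBlock, h, Prod.mk_zero_zero]

theorem elim_xxzString_headedBlock (i : Fin ℓ) :
    Sum.elim (0 : PauliString (Fin n)) (xxzString (headedBlock β i)) =
      codeString finSumFinEquiv β (0, Pi.single i 1) := by
  refine register_ext finSumFinEquiv (fun j => rfl) (fun j => ?_) fun i' => ?_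
  · rw [codeString_copy, Sum.elim_inr, finSumFinEquiv_apply_left, xxzString_headedBlock_castAdd]
    by_cases h : β j = i <;> simp [h, Prod.mk_zero_zero]
  · rw [codeString_head, Sum.elim_inr, finSumFinEquiv_apply_right, xxzString_headedBlock_natAdd]
    by_cases h : i' = i <;> simp [h, Prod.mk_zero_zero]

/-- The assignment of the qubits to blocks by their residues modulo the number of blocks. -/
def residueLabel (hℓ : 0 < ℓ) (j : Fin n) : Fin ℓ := ⟨j % ℓ, Nat.mod_lt _ hℓ⟩

theorem card_headedBlock_residueLabel (hℓ : 0 < ℓ) (i : Fin ℓ) :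
    (headedBlock (residueLabel (n := n) hℓ) i).card =
      if (i : ℕ) < (n + ℓ) % ℓ then (n + ℓ) / ℓ + 1 else (n + ℓ) / ℓ := by
  have hlabel : ∀ j : Fin n, residueLabel hℓ j = i ↔ (j : ℕ) ≡ i [MOD ℓ] := fun j => by
    rw [Fin.ext_iff, residueLabel, Nat.ModEq, Nat.mod_eq_of_lt i.2]
  have hcount := Nat.count_modEq_card n hℓ i
  rw [Nat.count_eq_card_filter_range, Finset.card_filter, Finset.sum_range,
    Nat.mod_eq_of_lt i.2] at hcount
  rw [card_headedBlock, Fintype.card_subtype, Finset.card_filter]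
  simp only [hlabel, hcount, Nat.add_mod_right, Nat.add_div_right n hℓ]
  split_ifs <;> rfl

theorem card_isBlockVisible_residueLabel (hℓ : 0 < ℓ) :
    (Nat.card {p : PauliString (Fin n) // IsBlockVisible (residueLabel hℓ) p} : ℝ) =
      dopedBound ℓ ((n + ℓ) / ℓ) ((n + ℓ) % ℓ) := by
  set a := (n + ℓ) / ℓ
  set r := (n + ℓ) % ℓ
  have hblock : ∀ i, (Nat.card {p : PauliString {j : Fin n // residueLabel hℓ j = i} //
      IsBlockVisible (fun _ => ()) p} : ℝ) =
        if (i : ℕ) < r then (3 ^ (a + 1) - 1) / 2 else (3 ^ a - 1) / 2 := fun i => by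
    have h := two_mul_card_isBlockVisible_unit {j : Fin n // residueLabel hℓ j = i}
    rw [← card_headedBlock, card_headedBlock_residueLabel] at h
    split_ifs at h ⊢ <;> linarith
  have hr : r ≤ ℓ := (Nat.mod_lt _ hℓ).le
  have hpow : (2 : ℝ) ^ ℓ = 2 ^ r * 2 ^ (ℓ - r) := by rw [← pow_add, Nat.add_sub_cancel' hr]
  rw [card_isBlockVisible, Nat.cast_prod, Finset.prod_congr rfl fun i _ => hblock i,
    Finset.prod_ite, Finset.prod_const, Finset.prod_const, Finset.filter_not,
    Finset.card_sdiff_of_subset (Finset.filter_subset _ _), Fin.card_filter_val_lt,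
    Finset.card_univ, Fintype.card_fin, min_eq_right hr, dopedBound, div_pow, div_pow, hpow]
  field_simp

end Blocks

theorem exists_isGreatest_povmDim {n m t : ℕ} {μ : (Fin n ⊕ Fin m → Fin 2) → QOp (Fin n)}
    (hμ : IsDopedPOVM n m t μ) :
    ∃ A, IsGreatest {s : ℕ | ∃ μ, IsDopedPOVM n m t μ ∧ s = povmDim μ} A ∧ povmDim μ ≤ A := by
  have hbdd : BddAbove {s : ℕ | ∃ μ, IsDopedPOVM n m t μ ∧ s = povmDim μ} := by
    refine ⟨Module.finrank ℂ (QOp (Fin n)), ?_⟩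
    rintro _ ⟨ν, -, rfl⟩
    exact Submodule.finrank_le _
  have hmem : povmDim μ ∈ {s : ℕ | ∃ μ, IsDopedPOVM n m t μ ∧ s = povmDim μ} := ⟨μ, hμ, rfl⟩
  exact ⟨_, ⟨Nat.sSup_mem ⟨_, hmem⟩ hbdd, fun s hs => le_csSup hbdd hs⟩, le_csSup hbdd hmem⟩

theorem theorem7 (n m t ℓ a r : ℕ) (hn : 1 ≤ n) (hm : n ≤ m) (ht : n < t)
    (hℓ : ℓ = t - n) (ha : a = t / ℓ) (hr : r = t - a * ℓ) :
    (∃ A : ℕ, IsGreatest {s : ℕ | ∃ μ, IsDopedPOVM n m t μ ∧ s = povmDim μ} A ∧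
      dopedBound ℓ a r ≤ (A : ℝ)) ∧
    (∃ (μ : (Fin n ⊕ Fin m → Fin 2) → QOp (Fin n)) (B : Fin ℓ → Finset (Fin t))
      (S : AddSubgroup (PauliString (Fin n ⊕ Fin t)))
      (Φ : OrthonormalBasis (Fin n ⊕ Fin t → Fin 2) ℂ (QSpace (Fin n ⊕ Fin t))),
      IsDopedPOVM n m t μ ∧ (povmDim μ : ℝ) = dopedBound ℓ a r ∧
      (∀ i j, i ≠ j → Disjoint (B i) (B j)) ∧
      (∀ i, (B i).card = if (i : ℕ) < r then a + 1 else a) ∧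
      (∀ p : PauliString (Fin n), Sum.elim p (0 : PauliString (Fin t)) ∈ S → p = 0) ∧
      (∀ q : PauliString (Fin t), Sum.elim (0 : PauliString (Fin n)) q ∈ S ↔
        q ∈ AddSubgroup.closure (Set.range fun i => xxzString (B i))) ∧
      IsStabilizerBasisOf S Φ ∧
      povmSpan μ = povmSpan (effectivePOVM 1 (magicState (Fin t)) Φ)) := by
  refine (and_iff_right_of_imp ?_).mpr ?_
  · rintro ⟨μ, _, _, _, hμ, hdim, -⟩
    obtain ⟨A, hA, hle⟩ := exists_isGreatest_povmDim hμ
    exact ⟨A, hA, hdim ▸ Nat.cast_le.mpr hle⟩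
  have hpos : 0 < ℓ := by omega
  obtain rfl : t = n + ℓ := by omega
  obtain rfl : r = (n + ℓ) % ℓ := by rw [hr, ha, Nat.mod_eq_sub, mul_comm]
  subst ha
  have : Nonempty (Fin m) := ⟨⟨0, by omega⟩⟩
  let β : Fin n → Fin ℓ := residueLabel hpos
  let f : Fin n ↪ Fin m := Fin.castLEEmb hm
  obtain ⟨U, hU, hN⟩ := exists_isDoped_hasEffectiveSupport_isBlockVisible f β
  rw [Fintype.card_fin, Fintype.card_fin] at hU
  obtain ⟨Φ, hΦ⟩ := exists_isStabilizerBasisOf (isStabilizerGroup_bellGroup f)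
  obtain ⟨Φ', hΦ'⟩ := exists_isStabilizerBasisOf (isStabilizerGroup_codeGroup finSumFinEquiv β)
  have hspan := hN.povmSpan_eq hΦ
  have hspan' := hasEffectiveSupport_one_magic.povmSpan_eq hΦ'
  simp only [exists_mem_bellGroup_iff] at hspan
  simp only [exists_mem_codeGroup_iff] at hspan'
  refine ⟨_, headedBlock β, _, Φ', ⟨U, _, Φ, hU, isStabilizerState_plus, ⟨_, hΦ⟩, rfl⟩, ?_,
    fun _ _ => disjoint_headedBlock β, card_headedBlock_residueLabel hpos,
    fun _ => eq_zero_of_elim_zero_mem_codeGroup _ β,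
    fun _ => elim_zero_mem_codeGroup_iff _ β (elim_xxzString_headedBlock β), hΦ',
    hspan.trans hspan'.symm⟩
  rw [povmDim, hspan, finrank_span_pauliOp, card_isBlockVisible_residueLabel]
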